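/- **Setting.** Let $\ell>0$, $a_1<a_2$, $b_1\ge 0$ and $b_2>b_1+\ell+a_2-a_1$. Let $\bar\gamma_i=\{(x,t): x=a_i,\ b_i\le t\le b_i+\ell\}$ ($i=1,2$) and $\Omega=\{(x,t)\in\mathbb R^2: t>0\}\setminus(\bar\gamma_1\cup\bar\gamma_2)$. Let $\phi\in C^2(\mathbb R)$ and $\psi\in C^1(\mathbb R)$. Write $(x,\tau)\to(A\pm0,B)$ for convergence to $(A,B)$ through points with $x>A$ (sign $+$), respectively $x<A$ (sign $-$), and $[F]_{x=A}(B)=\lim_{(x,\tau)\to(A+0,B)}F(x,\tau)-\lim_{(x,\tau)\to(A-0,B)}F(x,\tau)$. A *strengthened classical solution* is a function $u\in C^2(\Omega)\cap C^1(\Omega\cup\{t=0\})$ with $u_{tt}-u_{xx}=0$ in $\Omega$, $u(x,0)=\phi(x)$ and $u_t(x,0)=\psi(x)$ for all $x\in\mathbb R$, such that for all $i\in\{1,2\}$ and $t\in[0,\ell]$ the limits of $u$, $u_x$, $u_t$ as $(x,\tau)\to(a_i\pm0,b_i+t)$ exist, and such that for $F=u$ and $F=u_x$ and all $t\in[0,\ell]$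 $$\lim_{(x,\tau)\to(a_1\mp0,\,b_1+t)}F(x,\tau)=\lim_{(x,\tau)\to(a_2\pm0,\,b_2+t)}F(x,\tau)$$ (upper signs together, lower signs together). Uniqueness is understood as equality on $\Omega\cup\{t=0\}$. Let $u^D(x,t)=\frac12[\phi(x+t)+\phi(x-t)]+\frac12\int_{x-t}^{x+t}\psi(s)\,ds$ for $(x,t)\in\mathbb R^2$, and $$D_1(t)=u^D(a_2,b_2+t)-u^D(a_1,b_1+t),\qquad D_2(t)=u^D_x(a_2,b_2+t)-u^D_x(a_1,b_1+t).$$ Let $\theta(t)=1$ for $t>0$ and $\theta(t)=0$ for $t\le0$, let $\operatorname{sign}0=0$, and put $$\omega(t)=\theta(t)\theta(\ell-t)\bigl(u^D_t(a_2,b_2+t)-u^D_t(a_1,b_1+t)\bigr),$$ $$\nu(t)=\theta(t)\theta(\ell-t)\int_0^t\bigl(u^D_x(a_2,b_2+\tau)-u^D_x(a_1,b_1+\tau)\bigr)\,d\tau,$$ $$U(x,t)=\tfrac12\,\theta(t-|x|)\int_0^{t-|x|}\omega(\tau)\,d\tau-\theta(t-|x|)\,\frac{\operatorname{sign}x}{2}\,\nu(t-|x|).$$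 **Theorem.** There exists a unique strengthened classical solution if and only if $$D_1'(0)=D_1'(\ell)=0,\quad D_1(0)+D_1(\ell)=0,\quad D_1''(0)=D_1''(\ell)=0,$$ $$\int_0^\ell D_2(\tau)\,d\tau=0,\quad D_2(0)=D_2(\ell)=0,\quad D_2'(0)=D_2'(\ell)=0.$$ When these conditions hold, the solution is $$u(x,t)=u^D(x,t)+U(x-a_1,t-b_1)-U(x-a_2,t-b_2).$$ Moreover, every strengthened classical solution coincides on $\Omega\cup\{t=0\}$ with this function, and for $t\in[0,\ell]$ its jumps at the upper slit are $[u]_{x=a_2}(b_2+t)=\nu(t)$ and $[u_x]_{x=a_2}(b_2+t)=\omega(t)$. -/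

import Mathlib

open Set Filter Topology

noncomputable section

namespace SlitWave

/-- Position of the two slits: the lower slit is `x = a₁, b₁ < t < b₁ + ℓ`, the upper slit is
`x = a₂, b₂ < t < b₂ + ℓ`. Points of the plane are pairs `(x, t)`. -/
structure Slits where
  a₁ : ℝ
  b₁ : ℝ
  a₂ : ℝ
  b₂ : ℝ
  ℓ : ℝ

/-- The closed vertical segment `x = a, b ≤ t ≤ b + ℓ`. -/
def closedSlit (a b ℓ : ℝ) : Set (ℝ × ℝ) := {p | p.1 = a ∧ b ≤ p.2 ∧ p.2 ≤ b + ℓ}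

/-- `Ω`: the open half-plane `t > 0` without the two closed slits. -/
def Slits.Omega (S : Slits) : Set (ℝ × ℝ) :=
  {p | 0 < p.2} \ (closedSlit S.a₁ S.b₁ S.ℓ ∪ closedSlit S.a₂ S.b₂ S.ℓ)

/-- `Ω ∪ {t = 0}`, the set on which solutions live. -/
def Slits.Dom (S : Slits) : Set (ℝ × ℝ) := S.Omega ∪ {p | p.2 = 0}

/-- The partial derivative `u_x` of a function on `Ω ∪ {t = 0}` (one-sided in time at `t = 0`). -/
def Slits.dx (S : Slits) (u : ℝ × ℝ → ℝ) (p : ℝ × ℝ) : ℝ := fderivWithin ℝ u S.Dom p (1, 0)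

/-- The partial derivative `u_t` of a function on `Ω ∪ {t = 0}` (one-sided in time at `t = 0`). -/
def Slits.dt (S : Slits) (u : ℝ × ℝ → ℝ) (p : ℝ × ℝ) : ℝ := fderivWithin ℝ u S.Dom p (0, 1)

/-- `(x, τ) → (A - 0, B)`: convergence to `(A, B)` through points of the domain with `x < A`. -/
def Slits.fromLeft (S : Slits) (A B : ℝ) : Filter (ℝ × ℝ) := 𝓝[S.Dom ∩ {p | p.1 < A}] (A, B)

/-- `(x, τ) → (A + 0, B)`: convergence to `(A, B)` through points of the domain with `A < x`. -/
def Slits.fromRight (S : Slits) (A B : ℝ) : Filter (ℝ × ℝ) := 𝓝[S.Dom ∩ {p | A < p.1}] (A, B)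

/-- The limit of `F` along `l` exists (as a real number). -/
def LimExists (F : ℝ × ℝ → ℝ) (l : Filter (ℝ × ℝ)) : Prop := ∃ L : ℝ, Tendsto F l (𝓝 L)

/-- The limits of `F` along `l` and of `G` along `m` exist and coincide. -/
def LimEq (F : ℝ × ℝ → ℝ) (l : Filter (ℝ × ℝ)) (G : ℝ × ℝ → ℝ) (m : Filter (ℝ × ℝ)) : Prop :=
  ∃ L : ℝ, Tendsto F l (𝓝 L) ∧ Tendsto G m (𝓝 L)

/-- The jump `F(A + 0, B) - F(A - 0, B)` exists (both one-sided limits do) and equals `j`. -/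
def Slits.HasJump (S : Slits) (F : ℝ × ℝ → ℝ) (A B j : ℝ) : Prop :=
  ∃ r l : ℝ, Tendsto F (S.fromRight A B) (𝓝 r) ∧ Tendsto F (S.fromLeft A B) (𝓝 l) ∧ r - l = j

/-- `F` has one-sided limits from both sides at every point of both closed slits. -/
def Slits.SideLimits (S : Slits) (F : ℝ × ℝ → ℝ) : Prop :=
  ∀ t ∈ Icc 0 S.ℓ,
    LimExists F (S.fromLeft S.a₁ (S.b₁ + t)) ∧ LimExists F (S.fromRight S.a₁ (S.b₁ + t)) ∧
    LimExists F (S.fromLeft S.a₂ (S.b₂ + t)) ∧ LimExists F (S.fromRight S.a₂ (S.b₂ + t))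

/-- The class `𝓚`: `u ∈ C²(Ω) ∩ C¹(Ω ∪ {t = 0})`, and `u`, `u_x`, `u_t` have one-sided limits at
every point of the closed slits. -/
structure Slits.ClassK (S : Slits) (u : ℝ × ℝ → ℝ) : Prop where
  contDiff_two : ContDiffOn ℝ 2 u S.Omega
  contDiff_one : ContDiffOn ℝ 1 u S.Dom
  lim_u : S.SideLimits u
  lim_dx : S.SideLimits (S.dx u)
  lim_dt : S.SideLimits (S.dt u)

/-- The gluing condition for `F`: outer edges of the slits are glued with each other, and so are
the inner edges (end points included). -/
def Slits.Glued (S : Slits) (F : ℝ × ℝ → ℝ) : Prop :=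
  ∀ t ∈ Icc 0 S.ℓ,
    LimEq F (S.fromLeft S.a₁ (S.b₁ + t)) F (S.fromRight S.a₂ (S.b₂ + t)) ∧
    LimEq F (S.fromRight S.a₁ (S.b₁ + t)) F (S.fromLeft S.a₂ (S.b₂ + t))

/-- Strengthened classical solutions of the Cauchy problem with data `φ`, `ψ` for the wave
equation on the half-plane with two glued slits. -/
structure Slits.IsStrongSol (S : Slits) (φ ψ : ℝ → ℝ) (u : ℝ × ℝ → ℝ) : Prop where
  classK : S.ClassK u
  wave : ∀ p ∈ S.Omega, S.dt (S.dt u) p - S.dx (S.dx u) p = 0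
  init : ∀ x, u (x, 0) = φ x
  init_dt : ∀ x, S.dt u (x, 0) = ψ x
  glue_u : S.Glued u
  glue_dx : S.Glued (S.dx u)

/-- The d'Alembert solution `u^D`, on the whole plane. -/
def uD (φ ψ : ℝ → ℝ) (p : ℝ × ℝ) : ℝ :=
  (φ (p.1 + p.2) + φ (p.1 - p.2)) / 2 + (∫ s in (p.1 - p.2)..(p.1 + p.2), ψ s) / 2

/-- `u^D_x`. -/
def uDx (φ ψ : ℝ → ℝ) (p : ℝ × ℝ) : ℝ := fderiv ℝ (uD φ ψ) p (1, 0)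

/-- `u^D_t`. -/
def uDt (φ ψ : ℝ → ℝ) (p : ℝ × ℝ) : ℝ := fderiv ℝ (uD φ ψ) p (0, 1)

/-- `D₁(t) = u^D(a₂, b₂ + t) - u^D(a₁, b₁ + t)`. -/
def Slits.D₁ (S : Slits) (φ ψ : ℝ → ℝ) (t : ℝ) : ℝ :=
  uD φ ψ (S.a₂, S.b₂ + t) - uD φ ψ (S.a₁, S.b₁ + t)

/-- `D₂(t) = u^D_x(a₂, b₂ + t) - u^D_x(a₁, b₁ + t)`. -/
def Slits.D₂ (S : Slits) (φ ψ : ℝ → ℝ) (t : ℝ) : ℝ :=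
  uDx φ ψ (S.a₂, S.b₂ + t) - uDx φ ψ (S.a₁, S.b₁ + t)

/-- The solvability conditions on the initial data. -/
structure Slits.Solvable (S : Slits) (φ ψ : ℝ → ℝ) : Prop where
  deriv_D₁_zero : deriv (S.D₁ φ ψ) 0 = 0
  deriv_D₁_ℓ : deriv (S.D₁ φ ψ) S.ℓ = 0
  D₁_add : S.D₁ φ ψ 0 + S.D₁ φ ψ S.ℓ = 0
  deriv2_D₁_zero : deriv (deriv (S.D₁ φ ψ)) 0 = 0
  deriv2_D₁_ℓ : deriv (deriv (S.D₁ φ ψ)) S.ℓ = 0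
  integral_D₂ : ∫ τ in (0 : ℝ)..S.ℓ, S.D₂ φ ψ τ = 0
  D₂_zero : S.D₂ φ ψ 0 = 0
  D₂_ℓ : S.D₂ φ ψ S.ℓ = 0
  deriv_D₂_zero : deriv (S.D₂ φ ψ) 0 = 0
  deriv_D₂_ℓ : deriv (S.D₂ φ ψ) S.ℓ = 0

/-- The Heaviside function. -/
def heaviside (t : ℝ) : ℝ := if 0 < t then 1 else 0

/-- `ω(t) = θ(t) θ(ℓ - t) (u^D_t(a₂, b₂ + t) - u^D_t(a₁, b₁ + t))`. -/
def Slits.omega (S : Slits) (φ ψ : ℝ → ℝ) (t : ℝ) : ℝ :=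
  heaviside t * heaviside (S.ℓ - t) *
    (uDt φ ψ (S.a₂, S.b₂ + t) - uDt φ ψ (S.a₁, S.b₁ + t))

/-- `ν(t) = θ(t) θ(ℓ - t) ∫₀ᵗ (u^D_x(a₂, b₂ + τ) - u^D_x(a₁, b₁ + τ)) dτ`. -/
def Slits.nu (S : Slits) (φ ψ : ℝ → ℝ) (t : ℝ) : ℝ :=
  heaviside t * heaviside (S.ℓ - t) *
    ∫ τ in (0 : ℝ)..t, (uDx φ ψ (S.a₂, S.b₂ + τ) - uDx φ ψ (S.a₁, S.b₁ + τ))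

/-- `U(x, t) = ½ θ(t - |x|) ∫₀^{t - |x|} ω - ½ θ(t - |x|) sign(x) ν(t - |x|)`. -/
def Slits.U (S : Slits) (φ ψ : ℝ → ℝ) (x t : ℝ) : ℝ :=
  1 / 2 * heaviside (t - |x|) * (∫ τ in (0 : ℝ)..(t - |x|), S.omega φ ψ τ)
    - heaviside (t - |x|) * (Real.sign x / 2) * S.nu φ ψ (t - |x|)

/-- `u(x, t) = u^D(x, t) + U(x - a₁, t - b₁) - U(x - a₂, t - b₂)`. -/
def Slits.solution (S : Slits) (φ ψ : ℝ → ℝ) (p : ℝ × ℝ) : ℝ :=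
  uD φ ψ p + S.U φ ψ (p.1 - S.a₁) (p.2 - S.b₁) - S.U φ ψ (p.1 - S.a₂) (p.2 - S.b₂)

end SlitWave

end

/-!
Write `w = u - u^D`. It solves the wave equation in `Ω` with zero Cauchy data, so `w_t ± w_x` is
constant along characteristics as long as they stay in `Ω` (`IsCauchySol.charDeriv_eq`), and it
vanishes wherever the backward characteristic reaches `t = 0` without meeting a slit. Hence the
only waves are those emitted by the slits. Because the upper slit lies strictly above the forward
light cone of the lower one, each side of each slit sees just one outgoing wave, and the traces of
`w` and `w_x` there are read off from the profile of that wave on a vertical line away from the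
slits (`IsCauchySol.tendsto_side`). Three lines suffice: one on the left, one on the right, and the
line halfway between the slits, which serves both inner sides.

The gluing conditions thus become
`D₁(t) = Q(b₁ + t) - P(b₂ + t) = R(b₁ + t) - R(b₂ + t)` and
`D₂(t) = Q'(b₁ + t) + P'(b₂ + t) = -(R'(b₁ + t) + R'(b₂ + t))` on `[0, ℓ]`, where `Q`, `R`, `P` are
the left, middle and right profiles (`IsCauchySol.glue_relations`).

*Necessity.* The profile `R` is twice differentiable, and constant before, between and after the
time intervals of the slits, so its first two derivatives vanish at the times of the four tips;
this gives the pointwise conditions on `D₁'`, `D₁''`, `D₂`, `D₂'`. Integrating the two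
expressions for `D₂` gives the common final value of `P` and `R` with opposite signs, so that
value, `∫ D₂` and `D₁(0) + D₁(ℓ)` are all zero (`IsCauchySol.solvable`).

*Uniqueness.* For the difference of two solutions `D₁ = D₂ = 0`, so all profiles are stationary on
the slits, no waves are emitted, and the difference vanishes (`IsCauchySol.eq_zero_of_glued`).

*Existence.* The function `U` is of the form `A(t - |x|) + sign x · B(t - |x|)`, where `A'` and `B`
vanish outside `(0, ℓ)`. This class is closed under both partial derivatives
(`hasFDerivAt_outgoing`), also at the tips of the slits, so smoothness up to order two and the wave
equation follow from those of the truncated functions `ω` and `ν`; the solvability conditions say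
precisely that these can be truncated smoothly (`hasDerivAt_truncation`), except for
`D₁(0) + D₁(ℓ) = 0`, which compensates the constant that the lower wave leaves behind at the upper
slit. The traces at the slits are explicit, and so are the jumps.
-/

noncomputable section

namespace SlitWave

/-! ### Geometry of the slit half-plane -/

/-- The standing assumptions on the slits: the upper slit lies strictly above the forward light
cone of the lower one. -/
structure Slits.Admissible (S : Slits) : Prop where
  hℓ : 0 < S.ℓ
  hb₁ : 0 ≤ S.b₁
  ha : S.a₁ < S.a₂
  hb : S.b₁ + S.ℓ + S.a₂ - S.a₁ < S.b₂

theorem Slits.mem_Omega {S : Slits} {x t : ℝ} :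
    (x, t) ∈ S.Omega ↔ 0 < t ∧ ¬(x = S.a₁ ∧ S.b₁ ≤ t ∧ t ≤ S.b₁ + S.ℓ) ∧
      ¬(x = S.a₂ ∧ S.b₂ ≤ t ∧ t ≤ S.b₂ + S.ℓ) := by
  simp only [Slits.Omega, closedSlit, Set.mem_sdiff, mem_union, mem_ofPred_eq, not_or]

theorem Slits.Omega_subset_Dom (S : Slits) : S.Omega ⊆ S.Dom := subset_union_left

theorem Slits.mem_Dom_zero (S : Slits) (x : ℝ) : (x, (0 : ℝ)) ∈ S.Dom := Or.inr rfl

theorem Slits.mem_Omega_of_ne {S : Slits} {x t : ℝ} (ht : 0 < t) (h₁ : x ≠ S.a₁)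
    (h₂ : x ≠ S.a₂) : (x, t) ∈ S.Omega :=
  Slits.mem_Omega.2 ⟨ht, fun h => h₁ h.1, fun h => h₂ h.1⟩

theorem Slits.snd_nonneg_of_mem_Dom {S : Slits} {p : ℝ × ℝ} (hp : p ∈ S.Dom) : 0 ≤ p.2 := by
  rcases hp with hp | hp
  · exact hp.1.le
  · exact le_of_eq (Eq.symm hp)

theorem isClosed_closedSlit (a b ℓ : ℝ) : IsClosed (closedSlit a b ℓ) := by
  have h1 : IsClosed {p : ℝ × ℝ | p.1 = a} := isClosed_eq continuous_fst continuous_const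
  have h2 : IsClosed {p : ℝ × ℝ | b ≤ p.2} := isClosed_le continuous_const continuous_snd
  have h3 : IsClosed {p : ℝ × ℝ | p.2 ≤ b + ℓ} := isClosed_le continuous_snd continuous_const
  exact h1.inter (h2.inter h3)

theorem Slits.isOpen_Omega (S : Slits) : IsOpen S.Omega :=
  (isOpen_lt continuous_const continuous_snd).sdiff
    ((isClosed_closedSlit _ _ _).union (isClosed_closedSlit _ _ _))

theorem Slits.Dom_mem_nhds {S : Slits} {p : ℝ × ℝ} (hp : p ∈ S.Omega) : S.Dom ∈ 𝓝 p :=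
  mem_of_superset (S.isOpen_Omega.mem_nhds hp) S.Omega_subset_Dom

theorem eventually_ne_nhdsGT_zero (c : ℝ) : ∀ᶠ ε in 𝓝[>] (0 : ℝ), ε ≠ c := by
  rcases eq_or_ne c 0 with rfl | hc
  · filter_upwards [self_mem_nhdsWithin] with ε hε using ne_of_gt hε
  · exact (eventually_ne_nhds hc.symm).filter_mono nhdsWithin_le_nhds

theorem Slits.uniqueDiffOn_Dom (S : Slits) : UniqueDiffOn ℝ S.Dom := by
  rintro ⟨x, t⟩ hp
  rcases hp with hp | hp
  · exact (S.isOpen_Omega.uniqueDiffWithinAt hp).mono S.Omega_subset_Dom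
  · obtain rfl : t = 0 := hp
    -- a half-strip to the right of `x`, thin enough to avoid both slits, lies in `Ω`
    obtain ⟨δ, hδ, hsub⟩ : ∃ δ > 0, ∀ ε ∈ Ioo (0 : ℝ) δ, ε ≠ S.a₁ - x ∧ ε ≠ S.a₂ - x := by
      have := (eventually_ne_nhdsGT_zero (S.a₁ - x)).and (eventually_ne_nhdsGT_zero (S.a₂ - x))
      obtain ⟨δ, hδ, h⟩ := mem_nhdsGT_iff_exists_Ioo_subset.1 this
      exact ⟨δ, hδ, fun ε hε => h hε⟩
    have hC : Ioo x (x + δ) ×ˢ Ioi (0 : ℝ) ⊆ S.Dom := by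
      rintro ⟨y, s⟩ ⟨hy, hs⟩
      have := hsub (y - x) ⟨by linarith [hy.1], by linarith [hy.2]⟩
      exact S.Omega_subset_Dom (Slits.mem_Omega_of_ne hs (fun h => this.1 (by rw [h]))
        (fun h => this.2 (by rw [h])))
    refine (uniqueDiffWithinAt_convex ((convex_Ioo _ _).prod (convex_Ioi _)) ?_ ?_).mono hC
    · rw [(isOpen_Ioo.prod isOpen_Ioi).interior_eq]
      exact ⟨(x + δ / 2, 1), ⟨by constructor <;> linarith, by simp⟩⟩
    · rw [closure_prod_eq, closure_Ioo (by linarith), closure_Ioi]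
      exact ⟨left_mem_Icc.2 (by linarith), self_mem_Ici⟩

/-- Convergence to `(A, B)` through points of the domain to the right (`σ = 1`) or to the left
(`σ = -1`) of the line `x = A`. -/
def Slits.side (S : Slits) (σ A B : ℝ) : Filter (ℝ × ℝ) :=
  𝓝[S.Dom ∩ {p | 0 < σ * (p.1 - A)}] (A, B)

theorem Slits.fromRight_eq_side (S : Slits) (A B : ℝ) : S.fromRight A B = S.side 1 A B := by
  simp only [Slits.fromRight, Slits.side, one_mul, sub_pos]

theorem Slits.fromLeft_eq_side (S : Slits) (A B : ℝ) : S.fromLeft A B = S.side (-1) A B := by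
  simp only [Slits.fromLeft, Slits.side, neg_mul, one_mul, neg_sub, sub_pos]

theorem Slits.side_neBot (S : Slits) {σ : ℝ} (hσ : σ * σ = 1) (A : ℝ) {B : ℝ} (hB : 0 ≤ B) :
    (S.side σ A B).NeBot := by
  have hσ0 : σ ≠ 0 := by rintro rfl; simp at hσ
  have hc : Tendsto (fun ε : ℝ => (A + σ * ε, B + ε)) (𝓝[>] 0) (S.side σ A B) := by
    refine tendsto_nhdsWithin_iff.2 ⟨?_, ?_⟩
    · have : Continuous (fun ε : ℝ => (A + σ * ε, B + ε)) := by fun_prop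
      simpa using (this.tendsto 0).mono_left nhdsWithin_le_nhds
    · filter_upwards [self_mem_nhdsWithin, eventually_ne_nhdsGT_zero ((S.a₁ - A) / σ),
        eventually_ne_nhdsGT_zero ((S.a₂ - A) / σ)] with ε (h0 : 0 < ε) h1 h2
      refine ⟨S.Omega_subset_Dom (Slits.mem_Omega_of_ne (by linarith) ?_ ?_), ?_⟩
      · intro h; apply h1; rw [eq_div_iff hσ0]; linarith
      · intro h; apply h2; rw [eq_div_iff hσ0]; linarith
      · simp only [mem_ofPred_eq]
        have : σ * (A + σ * ε - A) = σ * σ * ε := by ring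
        rw [this, hσ, one_mul]; exact h0
  exact hc.neBot

theorem Slits.side_le_nhds (S : Slits) (σ A B : ℝ) : S.side σ A B ≤ 𝓝 (A, B) :=
  nhdsWithin_le_nhds

theorem Slits.Dom_mem_side (S : Slits) (σ A B : ℝ) : S.Dom ∈ S.side σ A B :=
  mem_of_superset self_mem_nhdsWithin inter_subset_left

/-! ### Partial derivatives and the Cauchy problem away from the slits -/

/-- The covector with components `a`, `b`, i.e. the differential of a function with partial
derivatives `a` in `x` and `b` in `t`. -/
def covec (a b : ℝ) : ℝ × ℝ →L[ℝ] ℝ :=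
  a • ContinuousLinearMap.fst ℝ ℝ ℝ + b • ContinuousLinearMap.snd ℝ ℝ ℝ

@[simp] theorem covec_apply (a b : ℝ) (v : ℝ × ℝ) : covec a b v = a * v.1 + b * v.2 := by
  simp [covec]

/-- A solution of the Cauchy problem for the wave equation in `Ω`, without any condition on the
slits. -/
structure Slits.IsCauchySol (S : Slits) (φ ψ : ℝ → ℝ) (u : ℝ × ℝ → ℝ) : Prop where
  contDiff_two : ContDiffOn ℝ 2 u S.Omega
  contDiff_one : ContDiffOn ℝ 1 u S.Dom
  wave : ∀ p ∈ S.Omega, S.dt (S.dt u) p - S.dx (S.dx u) p = 0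
  init : ∀ x, u (x, 0) = φ x
  init_dt : ∀ x, S.dt u (x, 0) = ψ x

theorem Slits.IsStrongSol.isCauchySol {S : Slits} {φ ψ : ℝ → ℝ} {u : ℝ × ℝ → ℝ}
    (h : S.IsStrongSol φ ψ u) : S.IsCauchySol φ ψ u :=
  ⟨h.classK.contDiff_two, h.classK.contDiff_one, h.wave, h.init, h.init_dt⟩

theorem Slits.fderivWithin_apply_eq (S : Slits) (u : ℝ × ℝ → ℝ) (p v : ℝ × ℝ) :
    fderivWithin ℝ u S.Dom p v = v.1 * S.dx u p + v.2 * S.dt u p := by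
  have : v = v.1 • ((1 : ℝ), (0 : ℝ)) + v.2 • ((0 : ℝ), (1 : ℝ)) := by ext <;> simp
  conv_lhs => rw [this]
  rw [map_add, map_smul, map_smul]
  rfl

theorem Slits.dx_eq_of_hasFDerivWithinAt {S : Slits} {u : ℝ × ℝ → ℝ} {p : ℝ × ℝ} {a b : ℝ}
    (hp : p ∈ S.Dom) (h : HasFDerivWithinAt u (covec a b) S.Dom p) : S.dx u p = a := by
  rw [Slits.dx, h.fderivWithin (S.uniqueDiffOn_Dom p hp)]; simp

theorem Slits.dt_eq_of_hasFDerivWithinAt {S : Slits} {u : ℝ × ℝ → ℝ} {p : ℝ × ℝ} {a b : ℝ}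
    (hp : p ∈ S.Dom) (h : HasFDerivWithinAt u (covec a b) S.Dom p) : S.dt u p = b := by
  rw [Slits.dt, h.fderivWithin (S.uniqueDiffOn_Dom p hp)]; simp

/-- On `Ω` the iterated partial derivatives of a `C²` function are values of its second
differential. -/
theorem Slits.wave_iff {S : Slits} {u : ℝ × ℝ → ℝ} (hu : ContDiffOn ℝ 2 u S.Omega)
    {p : ℝ × ℝ} (hp : p ∈ S.Omega) :
    S.dt (S.dt u) p - S.dx (S.dx u) p = 0 ↔
      fderiv ℝ (fderiv ℝ u) p (0, 1) (0, 1) = fderiv ℝ (fderiv ℝ u) p (1, 0) (1, 0) := by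
  have hd : DifferentiableAt ℝ (fderiv ℝ u) p := by
    have := hu.fderiv_of_isOpen (m := 1) S.isOpen_Omega (by norm_num)
    exact (this.contDiffAt (S.isOpen_Omega.mem_nhds hp)).differentiableAt (by norm_num)
  have key : ∀ v : ℝ × ℝ,
      fderivWithin ℝ (fun q => fderivWithin ℝ u S.Dom q v) S.Dom p v =
        fderiv ℝ (fderiv ℝ u) p v v := by
    intro v
    rw [fderivWithin_of_mem_nhds (Slits.Dom_mem_nhds hp)]
    have : (fun q => fderivWithin ℝ u S.Dom q v) =ᶠ[𝓝 p] fun q => fderiv ℝ u q v := by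
      filter_upwards [S.isOpen_Omega.mem_nhds hp] with q hq
      rw [fderivWithin_of_mem_nhds (Slits.Dom_mem_nhds hq)]
    rw [this.fderiv_eq, (hd.hasFDerivAt.clm_apply (hasFDerivAt_const v p)).fderiv]
    simp
  have h1 : S.dt (S.dt u) p = fderiv ℝ (fderiv ℝ u) p (0, 1) (0, 1) := key (0, 1)
  have h2 : S.dx (S.dx u) p = fderiv ℝ (fderiv ℝ u) p (1, 0) (1, 0) := key (1, 0)
  rw [h1, h2, sub_eq_zero]

theorem Slits.dx_sub {S : Slits} {u v : ℝ × ℝ → ℝ} (hu : ContDiffOn ℝ 1 u S.Dom)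
    (hv : ContDiffOn ℝ 1 v S.Dom) {p : ℝ × ℝ} (hp : p ∈ S.Dom) :
    S.dx (fun q => u q - v q) p = S.dx u p - S.dx v p := by
  simp only [Slits.dx]
  rw [fderivWithin_fun_sub (S.uniqueDiffOn_Dom p hp) (hu.differentiableOn (by norm_num) p hp)
    (hv.differentiableOn (by norm_num) p hp)]
  rfl

theorem Slits.dt_sub {S : Slits} {u v : ℝ × ℝ → ℝ} (hu : ContDiffOn ℝ 1 u S.Dom)
    (hv : ContDiffOn ℝ 1 v S.Dom) {p : ℝ × ℝ} (hp : p ∈ S.Dom) :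
    S.dt (fun q => u q - v q) p = S.dt u p - S.dt v p := by
  simp only [Slits.dt]
  rw [fderivWithin_fun_sub (S.uniqueDiffOn_Dom p hp) (hu.differentiableOn (by norm_num) p hp)
    (hv.differentiableOn (by norm_num) p hp)]
  rfl

theorem Slits.IsCauchySol.sub {S : Slits} {φ ψ φ' ψ' : ℝ → ℝ} {u v : ℝ × ℝ → ℝ}
    (hu : S.IsCauchySol φ ψ u) (hv : S.IsCauchySol φ' ψ' v) :
    S.IsCauchySol (φ - φ') (ψ - ψ') (fun p => u p - v p) where
  contDiff_two := hu.contDiff_two.sub hv.contDiff_two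
  contDiff_one := hu.contDiff_one.sub hv.contDiff_one
  wave p hp := by
    have hu' := hu.contDiff_two.fderiv_of_isOpen (m := 1) S.isOpen_Omega (by norm_num)
    have hv' := hv.contDiff_two.fderiv_of_isOpen (m := 1) S.isOpen_Omega (by norm_num)
    have hud := (hu'.contDiffAt (S.isOpen_Omega.mem_nhds hp)).differentiableAt (by norm_num)
    have hvd := (hv'.contDiffAt (S.isOpen_Omega.mem_nhds hp)).differentiableAt (by norm_num)
    have h1 := (Slits.wave_iff hu.contDiff_two hp).1 (hu.wave p hp)
    have h2 := (Slits.wave_iff hv.contDiff_two hp).1 (hv.wave p hp)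
    refine (Slits.wave_iff (hu.contDiff_two.sub hv.contDiff_two) hp).2 ?_
    have : fderiv ℝ (fun q => u q - v q) =ᶠ[𝓝 p] fun q => fderiv ℝ u q - fderiv ℝ v q := by
      filter_upwards [S.isOpen_Omega.mem_nhds hp] with q hq
      refine fderiv_fun_sub ?_ ?_
      · exact (hu.contDiff_two.contDiffAt (S.isOpen_Omega.mem_nhds hq)).differentiableAt
          (by norm_num)
      · exact (hv.contDiff_two.contDiffAt (S.isOpen_Omega.mem_nhds hq)).differentiableAt
          (by norm_num)
    rw [this.fderiv_eq, fderiv_fun_sub hud hvd]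
    simp only [sub_apply]
    rw [h1, h2]
  init x := by simp [hu.init, hv.init]
  init_dt x := by
    rw [Slits.dt_sub hu.contDiff_one hv.contDiff_one (S.mem_Dom_zero x)]
    simp [hu.init_dt, hv.init_dt]

/-! ### The d'Alembert solution -/

theorem hasFDerivAt_dAlembert {F G : ℝ → ℝ} {F' G' : ℝ} {p : ℝ × ℝ}
    (hF : HasDerivAt F F' (p.1 + p.2)) (hG : HasDerivAt G G' (p.1 - p.2)) :
    HasFDerivAt (fun q : ℝ × ℝ => F (q.1 + q.2) + G (q.1 - q.2)) (covec (F' + G') (F' - G')) p := by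
  have h1 := hF.hasFDerivAt.comp p (hasFDerivAt_fst.add hasFDerivAt_snd)
  have h2 := hG.hasFDerivAt.comp p (hasFDerivAt_fst.sub hasFDerivAt_snd)
  refine (h1.add h2).congr_fderiv ?_
  ext <;> simp
  ring

/-- The right-hand and left-hand waves that make up `u^D`. -/
theorem exists_uD_eq {φ ψ : ℝ → ℝ} (hφ : ContDiff ℝ 2 φ) (hψ : ContDiff ℝ 1 ψ) :
    ∃ F G : ℝ → ℝ, ContDiff ℝ 2 F ∧ ContDiff ℝ 2 G ∧
      (∀ p : ℝ × ℝ, uD φ ψ p = F (p.1 + p.2) + G (p.1 - p.2)) ∧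
      (∀ x, F x + G x = φ x) ∧ (∀ x, deriv F x - deriv G x = ψ x) := by
  have hΨ : ∀ x, HasDerivAt (fun y => ∫ s in (0 : ℝ)..y, ψ s) (ψ x) x := fun x =>
    intervalIntegral.integral_hasDerivAt_right (hψ.continuous.intervalIntegrable _ _)
      hψ.continuous.stronglyMeasurable.stronglyMeasurableAtFilter hψ.continuous.continuousAt
  have hΨ2 : ContDiff ℝ 2 (fun y => ∫ s in (0 : ℝ)..y, ψ s) := by
    refine (contDiff_succ_iff_deriv (n := 1)).2
      ⟨fun x => (hΨ x).differentiableAt, by simp, ?_⟩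
    rw [show deriv (fun y => ∫ s in (0 : ℝ)..y, ψ s) = ψ from funext fun x => (hΨ x).deriv]
    exact hψ
  refine ⟨fun x => (φ x + ∫ s in (0 : ℝ)..x, ψ s) / 2,
    fun x => (φ x - ∫ s in (0 : ℝ)..x, ψ s) / 2, (hφ.add hΨ2).div_const 2,
    (hφ.sub hΨ2).div_const 2, ?_, fun x => by ring, fun x => ?_⟩
  · intro p
    have := intervalIntegral.integral_interval_sub_left
      (hψ.continuous.intervalIntegrable (μ := MeasureTheory.volume) 0 (p.1 + p.2))
      (hψ.continuous.intervalIntegrable 0 (p.1 - p.2))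
    simp only [uD]
    rw [← this]; ring
  · have hφx := (hφ.differentiable (by norm_num) x).hasDerivAt
    rw [((hφx.fun_add (hΨ x)).div_const 2).deriv, ((hφx.fun_sub (hΨ x)).div_const 2).deriv]
    ring

section dAlembert

variable {φ ψ : ℝ → ℝ}

theorem contDiff_uD (hφ : ContDiff ℝ 2 φ) (hψ : ContDiff ℝ 1 ψ) : ContDiff ℝ 2 (uD φ ψ) := by
  obtain ⟨F, G, hF, hG, h, -, -⟩ := exists_uD_eq hφ hψ
  rw [show uD φ ψ = fun p => F (p.1 + p.2) + G (p.1 - p.2) from funext h]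
  exact (hF.comp (contDiff_fst.add contDiff_snd)).add (hG.comp (contDiff_fst.sub contDiff_snd))

theorem contDiff_uDx (hφ : ContDiff ℝ 2 φ) (hψ : ContDiff ℝ 1 ψ) : ContDiff ℝ 1 (uDx φ ψ) :=
  ((contDiff_uD hφ hψ).fderiv_right (m := 1) (by norm_num)).clm_apply contDiff_const

theorem contDiff_uDt (hφ : ContDiff ℝ 2 φ) (hψ : ContDiff ℝ 1 ψ) : ContDiff ℝ 1 (uDt φ ψ) :=
  ((contDiff_uD hφ hψ).fderiv_right (m := 1) (by norm_num)).clm_apply contDiff_const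

theorem hasFDerivAt_uD (hφ : ContDiff ℝ 2 φ) (hψ : ContDiff ℝ 1 ψ) (p : ℝ × ℝ) :
    HasFDerivAt (uD φ ψ) (covec (uDx φ ψ p) (uDt φ ψ p)) p := by
  have h := ((contDiff_uD hφ hψ).differentiable (by norm_num) p).hasFDerivAt
  refine h.congr_fderiv ?_
  ext <;> simp [uDx, uDt]

theorem Slits.dx_uD (S : Slits) (hφ : ContDiff ℝ 2 φ) (hψ : ContDiff ℝ 1 ψ) {p : ℝ × ℝ}
    (hp : p ∈ S.Dom) : S.dx (uD φ ψ) p = uDx φ ψ p :=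
  Slits.dx_eq_of_hasFDerivWithinAt hp (hasFDerivAt_uD hφ hψ p).hasFDerivWithinAt

theorem Slits.isCauchySol_uD (S : Slits) (hφ : ContDiff ℝ 2 φ) (hψ : ContDiff ℝ 1 ψ) :
    S.IsCauchySol φ ψ (uD φ ψ) where
  contDiff_two := (contDiff_uD hφ hψ).contDiffOn
  contDiff_one := ((contDiff_uD hφ hψ).of_le (by norm_num)).contDiffOn
  wave p hp := by
    refine (Slits.wave_iff (contDiff_uD hφ hψ).contDiffOn hp).2 ?_
    obtain ⟨F, G, hF, hG, h, -, -⟩ := exists_uD_eq hφ hψ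
    have hF1 : ContDiff ℝ 1 (deriv F) := ((contDiff_succ_iff_deriv (n := 1)).1 hF).2.2
    have hG1 : ContDiff ℝ 1 (deriv G) := ((contDiff_succ_iff_deriv (n := 1)).1 hG).2.2
    have hFd := fun x => (hF.differentiable (by norm_num) x).hasDerivAt
    have hGd := fun x => (hG.differentiable (by norm_num) x).hasDerivAt
    have hFd2 := fun x => (hF1.differentiable (by norm_num) x).hasDerivAt
    have hGd2 := fun x => (hG1.differentiable (by norm_num) x).hasDerivAt
    have e : fderiv ℝ (uD φ ψ) = fun q => covec (deriv F (q.1 + q.2) + deriv G (q.1 - q.2))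
        (deriv F (q.1 + q.2) - deriv G (q.1 - q.2)) := by
      funext q
      rw [show uD φ ψ = fun p => F (p.1 + p.2) + G (p.1 - p.2) from funext h]
      exact (hasFDerivAt_dAlembert (hFd _) (hGd _)).fderiv
    have d : DifferentiableAt ℝ (fderiv ℝ (uD φ ψ)) p :=
      ((contDiff_uD hφ hψ).fderiv_right (m := 1) (by norm_num)).differentiable (by norm_num) p
    have key : ∀ v : ℝ × ℝ, fderiv ℝ (fderiv ℝ (uD φ ψ)) p v v =
        fderiv ℝ (fun q => fderiv ℝ (uD φ ψ) q v) p v := by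
      intro v
      rw [(d.hasFDerivAt.clm_apply (hasFDerivAt_const v p)).fderiv]
      simp
    have h1 := hasFDerivAt_dAlembert (p := p) (hFd2 _) (hGd2 _)
    have h2 := hasFDerivAt_dAlembert (p := p) (hFd2 _) (hGd2 _).neg
    rw [key, key, e]
    simp only [covec_apply, mul_one, mul_zero, zero_add, add_zero, sub_eq_add_neg] at h1 h2 ⊢
    rw [h1.fderiv]
    erw [h2.fderiv]
    simp
  init x := by simp [uD]
  init_dt x := by
    rw [Slits.dt_eq_of_hasFDerivWithinAt (S.mem_Dom_zero x)
      (hasFDerivAt_uD hφ hψ _).hasFDerivWithinAt]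
    obtain ⟨F, G, hF, hG, h, -, h'⟩ := exists_uD_eq hφ hψ
    have hFd := fun x => (hF.differentiable (by norm_num) x).hasDerivAt
    have hGd := fun x => (hG.differentiable (by norm_num) x).hasDerivAt
    rw [uDt, show uD φ ψ = fun p => F (p.1 + p.2) + G (p.1 - p.2) from funext h,
      (hasFDerivAt_dAlembert (hFd _) (hGd _)).fderiv]
    simp [h']

theorem Slits.hasDerivAt_D₁ (S : Slits) (hφ : ContDiff ℝ 2 φ) (hψ : ContDiff ℝ 1 ψ) (t : ℝ) :
    HasDerivAt (S.D₁ φ ψ) (uDt φ ψ (S.a₂, S.b₂ + t) - uDt φ ψ (S.a₁, S.b₁ + t)) t := by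
  have key : ∀ a b : ℝ, HasDerivAt (fun s => uD φ ψ (a, b + s)) (uDt φ ψ (a, b + t)) t := by
    intro a b
    have hc : HasDerivAt (fun s : ℝ => (a, b + s)) ((0 : ℝ), (1 : ℝ)) t :=
      (hasDerivAt_const t a).prodMk ((hasDerivAt_id t).const_add b)
    have := (hasFDerivAt_uD hφ hψ (a, b + t)).comp_hasDerivAt t hc
    exact this.congr_deriv (by simp)
  exact (key _ _).sub (key _ _)

theorem Slits.deriv_D₁_eq (S : Slits) (hφ : ContDiff ℝ 2 φ) (hψ : ContDiff ℝ 1 ψ) :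
    deriv (S.D₁ φ ψ) = fun t => uDt φ ψ (S.a₂, S.b₂ + t) - uDt φ ψ (S.a₁, S.b₁ + t) :=
  funext fun t => (S.hasDerivAt_D₁ hφ hψ t).deriv

theorem Slits.contDiff_deriv_D₁ (S : Slits) (hφ : ContDiff ℝ 2 φ) (hψ : ContDiff ℝ 1 ψ) :
    ContDiff ℝ 1 (deriv (S.D₁ φ ψ)) := by
  rw [S.deriv_D₁_eq hφ hψ]
  have := contDiff_uDt hφ hψ
  fun_prop

theorem Slits.contDiff_D₂ (S : Slits) (hφ : ContDiff ℝ 2 φ) (hψ : ContDiff ℝ 1 ψ) :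
    ContDiff ℝ 1 (S.D₂ φ ψ) := by
  have := contDiff_uDx hφ hψ
  unfold Slits.D₂
  fun_prop

end dAlembert

/-! ### Propagation along characteristics -/

/-- The derivative `w_t + ε w_x`; for `ε = ±1` it is constant along the characteristics
`x + ε t = const` of a solution. -/
def Slits.charDeriv (S : Slits) (ε : ℝ) (w : ℝ × ℝ → ℝ) (p : ℝ × ℝ) : ℝ :=
  S.dt w p + ε * S.dx w p

section Propagation

variable {S : Slits} {φ ψ : ℝ → ℝ} {w : ℝ × ℝ → ℝ}

theorem Slits.IsCauchySol.hasFDerivAt (hw : S.IsCauchySol φ ψ w) {p : ℝ × ℝ} (hp : p ∈ S.Omega) :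
    HasFDerivAt w (covec (S.dx w p) (S.dt w p)) p := by
  have h := ((hw.contDiff_two.contDiffAt (S.isOpen_Omega.mem_nhds hp)).differentiableAt
    (by norm_num)).hasFDerivAt
  refine h.congr_fderiv ?_
  rw [← fderivWithin_of_mem_nhds (Slits.Dom_mem_nhds hp)]
  ext <;> simp [Slits.fderivWithin_apply_eq]

theorem Slits.IsCauchySol.continuousOn (hw : S.IsCauchySol φ ψ w) : ContinuousOn w S.Dom :=
  hw.contDiff_one.continuousOn

theorem Slits.IsCauchySol.continuousOn_fderivWithin_apply (hw : S.IsCauchySol φ ψ w)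
    (v : ℝ × ℝ) : ContinuousOn (fun p => fderivWithin ℝ w S.Dom p v) S.Dom :=
  (hw.contDiff_one.continuousOn_fderivWithin S.uniqueDiffOn_Dom le_rfl).clm_apply
    continuousOn_const

theorem Slits.IsCauchySol.continuousOn_dt (hw : S.IsCauchySol φ ψ w) :
    ContinuousOn (S.dt w) S.Dom := hw.continuousOn_fderivWithin_apply (0, 1)

theorem Slits.IsCauchySol.hasFDerivAt_fderivWithin_apply (hw : S.IsCauchySol φ ψ w) {p : ℝ × ℝ}
    (hp : p ∈ S.Omega) (v : ℝ × ℝ) :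
    HasFDerivAt (fun q => fderivWithin ℝ w S.Dom q v)
      ((fderiv ℝ (fderiv ℝ w) p).flip v) p := by
  have hd : DifferentiableAt ℝ (fderiv ℝ w) p := by
    have := hw.contDiff_two.fderiv_of_isOpen (m := 1) S.isOpen_Omega (by norm_num)
    exact (this.contDiffAt (S.isOpen_Omega.mem_nhds hp)).differentiableAt (by norm_num)
  have : (fun q => fderivWithin ℝ w S.Dom q v) =ᶠ[𝓝 p] fun q => fderiv ℝ w q v := by
    filter_upwards [S.isOpen_Omega.mem_nhds hp] with q hq
    rw [fderivWithin_of_mem_nhds (Slits.Dom_mem_nhds hq)]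
  refine HasFDerivAt.congr_of_eventuallyEq ?_ this
  refine (hd.hasFDerivAt.clm_apply (hasFDerivAt_const v p)).congr_fderiv ?_
  ext <;> simp

/-- A function on the segment from `p` to `p + T v`, which lies in `Ω` except possibly for its
end in `Ω ∪ {t = 0}`, is constant if its derivative along `v` vanishes. -/
theorem Slits.eq_of_segment {f : ℝ × ℝ → ℝ} {f' : ℝ × ℝ → ℝ × ℝ →L[ℝ] ℝ} {p v : ℝ × ℝ} {T : ℝ}
    (hT : 0 ≤ T) (hf : ContinuousOn f S.Dom) (hf' : ∀ q ∈ S.Omega, HasFDerivAt f (f' q) q)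
    (hin : ∀ τ, 0 ≤ τ → τ < T → p + τ • v ∈ S.Omega) (hend : p + T • v ∈ S.Dom)
    (h0 : ∀ τ, 0 ≤ τ → τ < T → f' (p + τ • v) v = 0) : f (p + T • v) = f p := by
  have hmem : ∀ τ ∈ Icc 0 T, p + τ • v ∈ S.Dom := by
    intro τ hτ
    rcases hτ.2.lt_or_eq with h | h
    · exact S.Omega_subset_Dom (hin τ hτ.1 h)
    · rw [h]; exact hend
  have hcont : ContinuousOn (fun τ : ℝ => f (p + τ • v)) (Icc 0 T) :=
    hf.comp (by fun_prop) hmem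
  have := constant_of_has_deriv_right_zero hcont (fun τ hτ => ?_) T ⟨hT, le_rfl⟩
  · simpa using this
  · have hc : HasDerivAt (fun τ : ℝ => p + τ • v) v τ := by
      simpa using ((hasDerivAt_id τ).smul_const v).const_add p
    have := (hf' _ (hin τ hτ.1 hτ.2)).comp_hasDerivAt τ hc
    rw [h0 τ hτ.1 hτ.2] at this
    exact this.hasDerivWithinAt

theorem Slits.IsCauchySol.charDeriv_eq (hw : S.IsCauchySol φ ψ w) {ε x t T : ℝ} (hε : ε * ε = 1)
    (hT : 0 ≤ T) (hin : ∀ τ, 0 ≤ τ → τ < T → (x + ε * τ, t - τ) ∈ S.Omega)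
    (hend : (x + ε * T, t - T) ∈ S.Dom) :
    S.charDeriv ε w (x + ε * T, t - T) = S.charDeriv ε w (x, t) := by
  have hpt : ∀ τ : ℝ, (x, t) + τ • (ε, (-1 : ℝ)) = (x + ε * τ, t - τ) := by
    intro τ; ext <;> simp <;> ring
  have hG : S.charDeriv ε w = fun q => fderivWithin ℝ w S.Dom q (ε, 1) := by
    funext q; rw [Slits.fderivWithin_apply_eq, Slits.charDeriv]; ring
  have h := Slits.eq_of_segment (S := S) (f := fun q => fderivWithin ℝ w S.Dom q (ε, 1))
    (f' := fun q => (fderiv ℝ (fderiv ℝ w) q).flip (ε, 1)) (p := (x, t)) (v := (ε, -1)) hT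
    (hw.continuousOn_fderivWithin_apply _)
    (fun q hq => hw.hasFDerivAt_fderivWithin_apply hq _)
    (fun τ h0 h1 => by rw [hpt]; exact hin τ h0 h1) (by rw [hpt]; exact hend) ?_
  · rw [hG]; rwa [hpt] at h
  · intro τ h0 h1
    rw [hpt]
    have hq := hin τ h0 h1
    set q : ℝ × ℝ := (x + ε * τ, t - τ)
    have hwave := (Slits.wave_iff hw.contDiff_two hq).1 (hw.wave q hq)
    have hsymm : IsSymmSndFDerivAt ℝ w q :=
      (hw.contDiff_two.contDiffAt (S.isOpen_Omega.mem_nhds hq)).isSymmSndFDerivAt (by simp)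
    have hs := hsymm (1, 0) (0, 1)
    have e1 : ((ε, (1 : ℝ)) : ℝ × ℝ) = ε • ((1 : ℝ), (0 : ℝ)) + ((0 : ℝ), (1 : ℝ)) := by
      ext <;> simp
    have e2 : ((ε, (-1 : ℝ)) : ℝ × ℝ) = ε • ((1 : ℝ), (0 : ℝ)) - ((0 : ℝ), (1 : ℝ)) := by
      ext <;> simp
    rw [ContinuousLinearMap.flip_apply, e1, e2]
    simp only [map_add, map_sub, map_smul, sub_apply, smul_apply, smul_eq_mul]
    rw [hwave, hs]
    linear_combination (fderiv ℝ (fderiv ℝ w) q (1, 0) (1, 0)) * hε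

theorem Slits.IsCauchySol.eq_of_charDeriv_eq_zero (hw : S.IsCauchySol φ ψ w) {ε x t T : ℝ}
    (hT : 0 ≤ T) (hin : ∀ τ, 0 ≤ τ → τ < T → (x + ε * τ, t - τ) ∈ S.Omega)
    (hend : (x + ε * T, t - T) ∈ S.Dom)
    (h0 : ∀ τ, 0 ≤ τ → τ < T → S.charDeriv (-ε) w (x + ε * τ, t - τ) = 0) :
    w (x + ε * T, t - T) = w (x, t) := by
  have hpt : ∀ τ : ℝ, (x, t) + τ • (ε, (-1 : ℝ)) = (x + ε * τ, t - τ) := by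
    intro τ; ext <;> simp <;> ring
  have h := Slits.eq_of_segment (S := S) (f := w) (p := (x, t)) (v := (ε, -1)) hT
    hw.continuousOn (fun q hq => hw.hasFDerivAt hq)
    (fun τ h0 h1 => by rw [hpt]; exact hin τ h0 h1) (by rw [hpt]; exact hend)
    (fun τ h1 h2 => by
      have := h0 τ h1 h2
      rw [hpt]; simp only [covec_apply, Slits.charDeriv] at this ⊢; linarith)
  rwa [hpt] at h

theorem Slits.IsCauchySol.dx_zero (hw : S.IsCauchySol 0 0 w) (x : ℝ) : S.dx w (x, 0) = 0 := by
  have h := ((hw.contDiff_one.differentiableOn (by norm_num)) (x, 0)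
    (S.mem_Dom_zero x)).hasFDerivWithinAt
  have hc : HasDerivWithinAt (fun y : ℝ => (y, (0 : ℝ))) ((1 : ℝ), (0 : ℝ)) univ x :=
    ((hasDerivAt_id x).prodMk (hasDerivAt_const x (0 : ℝ))).hasDerivWithinAt
  have h1 := h.comp_hasDerivWithinAt x hc (fun y _ => S.mem_Dom_zero y)
  have h2 : w ∘ (fun y : ℝ => (y, (0 : ℝ))) = fun _ => 0 := by
    funext y; simp [hw.init]
  rw [h2, hasDerivWithinAt_univ] at h1
  exact h1.unique (hasDerivAt_const x 0)

theorem Slits.IsCauchySol.charDeriv_zero (hw : S.IsCauchySol 0 0 w) (ε x : ℝ) :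
    S.charDeriv ε w (x, 0) = 0 := by
  rw [Slits.charDeriv, hw.dx_zero, hw.init_dt]; simp

/-- With zero Cauchy data, `w_t + ε w_x` vanishes at every point whose backward characteristic
reaches the initial line without meeting a slit. -/
theorem Slits.IsCauchySol.charDeriv_eq_zero (hw : S.IsCauchySol 0 0 w) {ε x t : ℝ}
    (hε : ε * ε = 1) (ht : 0 ≤ t)
    (hin : ∀ τ, 0 ≤ τ → τ < t → (x + ε * τ, t - τ) ∈ S.Omega) :
    S.charDeriv ε w (x, t) = 0 := by
  rw [← hw.charDeriv_eq hε ht hin (by rw [sub_self]; exact S.mem_Dom_zero _), sub_self,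
    hw.charDeriv_zero]

theorem Slits.dt_eq_charDeriv (S : Slits) (w : ℝ × ℝ → ℝ) (p : ℝ × ℝ) :
    S.dt w p = (S.charDeriv 1 w p + S.charDeriv (-1) w p) / 2 := by
  simp only [Slits.charDeriv]; ring

/-- A solution with zero data vanishes at the top of a vertical segment on which `w_t = 0`. -/
theorem Slits.IsCauchySol.eq_zero_of_dt_eq_zero (hw : S.IsCauchySol 0 0 w) {x t : ℝ} (ht : 0 ≤ t)
    (h₁ : x ≠ S.a₁) (h₂ : x ≠ S.a₂) (h0 : ∀ s, 0 < s → s ≤ t → S.dt w (x, s) = 0) :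
    w (x, t) = 0 := by
  have hpt : ∀ τ : ℝ, (x, t) + τ • ((0 : ℝ), (-1 : ℝ)) = (x, t - τ) := by
    intro τ; ext <;> simp; ring
  have h := Slits.eq_of_segment (S := S) (f := w) (p := (x, t)) (v := (0, -1)) ht
    hw.continuousOn (fun q hq => hw.hasFDerivAt hq)
    (fun τ h0 h1 => by rw [hpt]; exact Slits.mem_Omega_of_ne (by linarith) h₁ h₂)
    (by rw [hpt, sub_self]; exact S.mem_Dom_zero _)
    (fun τ h1 h2 => by rw [hpt]; simp [h0 (t - τ) (by linarith) (by linarith)])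
  rw [hpt, sub_self, hw.init] at h
  exact h.symm

/-- One-sided traces. If near `(a, s)`, on the side `σ` of the line `x = a`, only the wave
travelling away from that line is present, then `w` and `w_x` have one-sided limits at `(a, s)`,
which can be read off on the vertical line at distance `h`. -/
theorem Slits.IsCauchySol.tendsto_side (hw : S.IsCauchySol 0 0 w) {σ a h s δ : ℝ}
    (hσ : σ * σ = 1) (hh : 0 < h) (hδ : 0 < δ) (hs : 0 ≤ s)
    (H : ∀ x t, 0 < t → 0 < σ * (x - a) → σ * (x - a) ≤ h → |t - σ * (x - a) - s| < δ →
      (x, t) ∈ S.Omega ∧ S.charDeriv σ w (x, t) = 0) :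
    Tendsto w (S.side σ a s) (𝓝 (w (a + σ * h, s + h))) ∧
      Tendsto (S.dx w) (S.side σ a s) (𝓝 (-σ * S.dt w (a + σ * h, s + h))) := by
  have hcol : σ * (a + σ * h - a) = h := by linear_combination h * hσ
  have hstart : (a + σ * h, s + h) ∈ S.Omega :=
    (H (a + σ * h) (s + h) (by linarith) (by rw [hcol]; exact hh) (by rw [hcol])
      (by rw [hcol]; simpa using hδ)).1
  have hmap : Tendsto (fun p : ℝ × ℝ => (a + σ * h, p.2 - σ * (p.1 - a) + h)) (S.side σ a s)
      (𝓝 (a + σ * h, s + h)) := by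
    have hc : Continuous fun p : ℝ × ℝ => (a + σ * h, p.2 - σ * (p.1 - a) + h) := by fun_prop
    have := (hc.tendsto (a, s)).mono_left (S.side_le_nhds σ a s)
    simpa using this
  have hev : ∀ᶠ p in S.side σ a s,
      w p = w (a + σ * h, p.2 - σ * (p.1 - a) + h) ∧
        S.dx w p = -σ * S.dt w (a + σ * h, p.2 - σ * (p.1 - a) + h) := by
    have c1 : ∀ᶠ p : ℝ × ℝ in S.side σ a s, σ * (p.1 - a) < h := by
      have hc : Continuous fun p : ℝ × ℝ => σ * (p.1 - a) := by fun_prop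
      have := (hc.tendsto (a, s)).mono_left (S.side_le_nhds σ a s)
      exact this.eventually_lt_const (by simpa using hh)
    have c2 : ∀ᶠ p : ℝ × ℝ in S.side σ a s, |p.2 - σ * (p.1 - a) - s| < δ := by
      have hc : Continuous fun p : ℝ × ℝ => |p.2 - σ * (p.1 - a) - s| := by fun_prop
      have := (hc.tendsto (a, s)).mono_left (S.side_le_nhds σ a s)
      exact this.eventually_lt_const (by simpa using hδ)
    have c3 : ∀ᶠ p : ℝ × ℝ in S.side σ a s, p ∈ S.Dom ∩ {p | 0 < σ * (p.1 - a)} :=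
      self_mem_nhdsWithin
    filter_upwards [c1, c2, c3] with p h1 h2 h3
    obtain ⟨x, t⟩ := p
    obtain ⟨hD, h4⟩ := h3
    simp only [mem_ofPred_eq] at h1 h2 h4 ⊢
    have ht : 0 ≤ t := Slits.snd_nonneg_of_mem_Dom hD
    -- descend from the vertical line `x = a + σ h` along the characteristic through `(x, t)`
    have hend : (a + σ * h + -σ * (h - σ * (x - a)),
        t - σ * (x - a) + h - (h - σ * (x - a))) = (x, t) := by
      ext
      · linear_combination (x - a) * hσ
      · ring
    have hseg : ∀ τ, 0 ≤ τ → τ < h - σ * (x - a) →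
        (a + σ * h + -σ * τ, t - σ * (x - a) + h - τ) ∈ S.Omega ∧
          S.charDeriv σ w (a + σ * h + -σ * τ, t - σ * (x - a) + h - τ) = 0 := by
      intro τ hτ0 hτ1
      have e : σ * (a + σ * h + -σ * τ - a) = h - τ := by linear_combination (h - τ) * hσ
      refine H _ _ (by linarith) (by rw [e]; linarith) (by rw [e]; linarith) ?_
      rw [e]
      convert h2 using 2; ring
    have hT : 0 ≤ h - σ * (x - a) := by linarith
    have k1 := hw.eq_of_charDeriv_eq_zero (ε := -σ) hT (fun τ h0 h1 => (hseg τ h0 h1).1)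
      (by rw [hend]; exact hD) (fun τ h0 h1 => by rw [neg_neg]; exact (hseg τ h0 h1).2)
    have k2 := hw.charDeriv_eq (ε := -σ) (by rw [neg_mul_neg, hσ]) hT
      (fun τ h0 h1 => (hseg τ h0 h1).1) (by rw [hend]; exact hD)
    rw [hend] at k1 k2
    have k3 : S.charDeriv σ w (x, t) = 0 := by
      rcases ht.lt_or_eq with h5 | h5
      · exact (H x t h5 h4 h1.le h2).2
      · rw [← h5]; exact hw.charDeriv_zero _ _
    have k4 : S.charDeriv σ w (a + σ * h, t - σ * (x - a) + h) = 0 := by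
      have := (hseg 0 le_rfl (by linarith)).2
      simpa using this
    refine ⟨k1, ?_⟩
    simp only [Slits.charDeriv] at k2 k3 k4
    have k5 : S.dt w (x, t) = S.dt w (a + σ * h, t - σ * (x - a) + h) := by linarith
    rw [← k5]
    linear_combination σ * k3 - S.dx w (x, t) * hσ
  have hD := Slits.Dom_mem_nhds hstart
  have t1 := ((hw.continuousOn.continuousAt hD).tendsto.comp hmap)
  have t2 := ((hw.continuousOn_dt.continuousAt hD).tendsto.comp hmap).const_mul (-σ)
  exact ⟨t1.congr' (hev.mono fun p hp => hp.1.symm), t2.congr' (hev.mono fun p hp => hp.2.symm)⟩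



end Propagation

/-! ### Absence of incoming waves -/

section Strips

variable {S : Slits} {w : ℝ × ℝ → ℝ}

/-- Right of the lower slit, no wave comes from the right except from the upper slit. -/
theorem Slits.IsCauchySol.charDeriv_one_mid (hw : S.IsCauchySol 0 0 w)
    {x t : ℝ} (ht : 0 < t) (h1 : S.a₁ < x)
    (h : t + x - S.a₂ < S.b₂ ∨ S.b₂ + S.ℓ < t + x - S.a₂) : S.charDeriv 1 w (x, t) = 0 := by
  refine hw.charDeriv_eq_zero (by norm_num) ht.le fun τ h0 h3 => Slits.mem_Omega.2
    ⟨by linarith, ?_, ?_⟩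
  · rintro ⟨e, -, -⟩; linarith
  · rintro ⟨e, e1, e2⟩; rcases h with h | h <;> linarith

/-- Left of the upper slit, no wave comes from the left except from the lower slit. -/
theorem Slits.IsCauchySol.charDeriv_neg_mid (hw : S.IsCauchySol 0 0 w)
    {x t : ℝ} (ht : 0 < t) (h2 : x < S.a₂)
    (h : t - x + S.a₁ < S.b₁ ∨ S.b₁ + S.ℓ < t - x + S.a₁) : S.charDeriv (-1) w (x, t) = 0 := by
  refine hw.charDeriv_eq_zero (by norm_num) ht.le fun τ h0 h3 => Slits.mem_Omega.2
    ⟨by linarith, ?_, ?_⟩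
  · rintro ⟨e, e1, e2⟩; rcases h with h | h <;> linarith
  · rintro ⟨e, -, -⟩; linarith

theorem Slits.IsCauchySol.charDeriv_neg_left (hS : S.Admissible) (hw : S.IsCauchySol 0 0 w)
    {x t : ℝ} (ht : 0 < t) (h1 : x < S.a₁) : S.charDeriv (-1) w (x, t) = 0 := by
  have := hS.ha
  exact hw.charDeriv_eq_zero (by norm_num) ht.le fun τ h0 h3 => Slits.mem_Omega_of_ne
    (by linarith) (by intro e; linarith) (by intro e; linarith)

theorem Slits.IsCauchySol.charDeriv_one_right (hS : S.Admissible) (hw : S.IsCauchySol 0 0 w)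
    {x t : ℝ} (ht : 0 < t) (h1 : S.a₂ < x) : S.charDeriv 1 w (x, t) = 0 := by
  have := hS.ha
  exact hw.charDeriv_eq_zero (by norm_num) ht.le fun τ h0 h3 => Slits.mem_Omega_of_ne
    (by linarith) (by intro e; linarith) (by intro e; linarith)

/-- A wave from the right that crosses the line of the lower slit outside that slit, and before
the upper slit could be felt there, vanishes. -/
theorem Slits.IsCauchySol.charDeriv_one_left (hS : S.Admissible) (hw : S.IsCauchySol 0 0 w)
    {x t : ℝ} (ht : 0 < t)
    (h : t + x - S.a₁ < S.b₁ ∨ (S.b₁ + S.ℓ < t + x - S.a₁ ∧ t + x - S.a₁ < S.b₂)) :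
    S.charDeriv 1 w (x, t) = 0 := by
  have h₁ := hS.ha
  have h₂ := hS.hb
  have h₃ := hS.hℓ
  refine hw.charDeriv_eq_zero (by norm_num) ht.le fun τ h0 h3 => Slits.mem_Omega.2
    ⟨by linarith, ?_, ?_⟩
  · rintro ⟨e, e1, e2⟩; rcases h with h | h <;> linarith
  · rintro ⟨e, e1, e2⟩; rcases h with h | h <;> linarith

/-- A wave from the left that crosses the line of the upper slit above that slit vanishes: it
is too late to have met the lower slit. -/
theorem Slits.IsCauchySol.charDeriv_neg_right (hS : S.Admissible) (hw : S.IsCauchySol 0 0 w)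
    {x t : ℝ} (ht : 0 < t) (h : S.b₂ + S.ℓ < t - x + S.a₂) :
    S.charDeriv (-1) w (x, t) = 0 := by
  have h₁ := hS.ha
  have h₂ := hS.hb
  have h₃ := hS.hℓ
  refine hw.charDeriv_eq_zero (by norm_num) ht.le fun τ h0 h3 => Slits.mem_Omega.2
    ⟨by linarith, ?_, ?_⟩
  · rintro ⟨e, e1, e2⟩; linarith
  · rintro ⟨e, e1, e2⟩; linarith

end Strips

/-! ### Wave profiles -/

/-- Half the distance between the lines carrying the slits. -/
def Slits.half (S : Slits) : ℝ := (S.a₂ - S.a₁) / 2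

/-- The profile of the wave read off on the vertical line through `x`. It is
used at distance `half` from a slit; the shift then makes the parameter the time at which the wave
left that slit. -/
def Slits.profile (S : Slits) (w : ℝ × ℝ → ℝ) (x s : ℝ) : ℝ := w (x, s + S.half)

/-- The derivative of the profile. -/
def Slits.profileDt (S : Slits) (w : ℝ × ℝ → ℝ) (x s : ℝ) : ℝ := S.dt w (x, s + S.half)

section Profiles

variable {S : Slits} {φ ψ : ℝ → ℝ} {w : ℝ × ℝ → ℝ} {s : ℝ}

theorem Slits.IsCauchySol.hasDerivAt_profile (hw : S.IsCauchySol φ ψ w) {x : ℝ} (h₁ : x ≠ S.a₁)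
    (h₂ : x ≠ S.a₂) (hs : -S.half < s) :
    HasDerivAt (S.profile w x) (S.profileDt w x s) s := by
  have hp : (x, s + S.half) ∈ S.Omega := Slits.mem_Omega_of_ne (by linarith) h₁ h₂
  have hc : HasDerivAt (fun s : ℝ => (x, s + S.half)) ((0 : ℝ), (1 : ℝ)) s :=
    (hasDerivAt_const s x).prodMk ((hasDerivAt_id s).add_const _)
  have := (hw.hasFDerivAt hp).comp_hasDerivAt s hc
  exact this.congr_deriv (by simp [Slits.profileDt])

theorem Slits.IsCauchySol.differentiableAt_profileDt (hw : S.IsCauchySol φ ψ w) {x : ℝ}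
    (h₁ : x ≠ S.a₁) (h₂ : x ≠ S.a₂) (hs : -S.half < s) :
    DifferentiableAt ℝ (S.profileDt w x) s := by
  have hp : (x, s + S.half) ∈ S.Omega := Slits.mem_Omega_of_ne (by linarith) h₁ h₂
  have hc : HasDerivAt (fun s : ℝ => (x, s + S.half)) ((0 : ℝ), (1 : ℝ)) s :=
    (hasDerivAt_const s x).prodMk ((hasDerivAt_id s).add_const _)
  exact ((hw.hasFDerivAt_fderivWithin_apply hp (0, 1)).comp_hasDerivAt s hc).differentiableAt

theorem Slits.Admissible.half_pos (hS : S.Admissible) : 0 < S.half := by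
  have := hS.ha
  simp only [Slits.half]; linarith

theorem Slits.a₁_add_half (S : Slits) : S.a₁ + S.half = S.a₂ - S.half := by
  simp only [Slits.half]; ring

/-- The profile in the middle strip is stationary away from the time intervals of the slits. -/
theorem Slits.IsCauchySol.profileDt_mid_eq_zero (hS : S.Admissible) (hw : S.IsCauchySol 0 0 w)
    (hs : -S.half < s)
    (h : s < S.b₁ ∨ (S.b₁ + S.ℓ < s ∧ s < S.b₂) ∨ S.b₂ + S.ℓ < s) :
    S.profileDt w (S.a₁ + S.half) s = 0 := by
  have h₀ := hS.half_pos
  have h₁ := hS.ha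
  have h₂ := hS.hb
  have h₃ := hS.hℓ
  have h₄ := S.a₁_add_half
  rw [Slits.profileDt, S.dt_eq_charDeriv,
    hw.charDeriv_one_mid (by linarith) (by linarith),
    hw.charDeriv_neg_mid (by linarith) (by linarith)]
  · norm_num
  · rcases h with h | h | h
    · left; linarith
    · right; linarith
    · right; linarith
  · rcases h with h | h | h
    · left; linarith
    · left; linarith
    · right; linarith

theorem Slits.IsCauchySol.profileDt_left_eq_zero (hS : S.Admissible) (hw : S.IsCauchySol 0 0 w)
    (hs : -S.half < s) (h : s < S.b₁ ∨ (S.b₁ + S.ℓ < s ∧ s < S.b₂)) :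
    S.profileDt w (S.a₁ - S.half) s = 0 := by
  have h₀ := hS.half_pos
  rw [Slits.profileDt, S.dt_eq_charDeriv,
    hw.charDeriv_one_left hS (by linarith),
    hw.charDeriv_neg_left hS (by linarith) (by linarith)]
  · norm_num
  · rcases h with h | h
    · left; linarith
    · right; constructor <;> linarith

theorem Slits.IsCauchySol.profile_mid_eq_zero (hS : S.Admissible) (hw : S.IsCauchySol 0 0 w)
    (hs : -S.half < s) (h : s < S.b₁) : S.profile w (S.a₁ + S.half) s = 0 := by
  have h₀ := hS.half_pos
  have h₄ := S.a₁_add_half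
  refine hw.eq_zero_of_dt_eq_zero (by linarith) (by linarith) (by intro e; linarith)
    fun r hr0 hr1 => ?_
  have := hw.profileDt_mid_eq_zero hS (s := r - S.half) (by linarith) (Or.inl (by linarith))
  rwa [Slits.profileDt, sub_add_cancel] at this

theorem Slits.IsCauchySol.profile_left_eq_zero (hS : S.Admissible) (hw : S.IsCauchySol 0 0 w)
    (hs : -S.half < s) (h : s < S.b₁) : S.profile w (S.a₁ - S.half) s = 0 := by
  have h₀ := hS.half_pos
  have h₁ := hS.ha
  refine hw.eq_zero_of_dt_eq_zero (by linarith) (by intro e; linarith) (by intro e; linarith)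
    fun r hr0 hr1 => ?_
  have := hw.profileDt_left_eq_zero hS (s := r - S.half) (by linarith) (Or.inl (by linarith))
  rwa [Slits.profileDt, sub_add_cancel] at this

/-! #### Traces of the profiles on the slits -/

theorem Slits.IsCauchySol.tendsto_lower_right (hS : S.Admissible) (hw : S.IsCauchySol 0 0 w)
    (hs : 0 ≤ s) (h : s < S.b₂) :
    Tendsto w (S.side 1 S.a₁ s) (𝓝 (S.profile w (S.a₁ + S.half) s)) ∧
      Tendsto (S.dx w) (S.side 1 S.a₁ s) (𝓝 (-S.profileDt w (S.a₁ + S.half) s)) := by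
  have h₀ := hS.half_pos
  have h₄ := S.a₁_add_half
  have := hw.tendsto_side (σ := 1) (a := S.a₁) (h := S.half) (δ := S.b₂ - s) (by norm_num) h₀
    (by linarith) hs (fun x t ht h1 h2 h3 => by
      have h3 := abs_lt.1 h3
      exact ⟨Slits.mem_Omega_of_ne ht (by intro e; linarith) (by intro e; linarith),
        hw.charDeriv_one_mid ht (by linarith) (Or.inl (by linarith))⟩)
  simpa [Slits.profile, Slits.profileDt] using this

theorem Slits.IsCauchySol.tendsto_lower_left (hS : S.Admissible) (hw : S.IsCauchySol 0 0 w)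
    (hs : 0 ≤ s) :
    Tendsto w (S.side (-1) S.a₁ s) (𝓝 (S.profile w (S.a₁ - S.half) s)) ∧
      Tendsto (S.dx w) (S.side (-1) S.a₁ s) (𝓝 (S.profileDt w (S.a₁ - S.half) s)) := by
  have h₀ := hS.half_pos
  have h₁ := hS.ha
  have := hw.tendsto_side (σ := -1) (a := S.a₁) (h := S.half) (δ := 1) (by norm_num) h₀
    (by linarith) hs (fun x t ht h1 h2 h3 => by
      exact ⟨Slits.mem_Omega_of_ne ht (by intro e; linarith) (by intro e; linarith),
        hw.charDeriv_neg_left hS ht (by linarith)⟩)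
  simpa [Slits.profile, Slits.profileDt, sub_eq_add_neg] using this

theorem Slits.IsCauchySol.tendsto_upper_right (hS : S.Admissible) (hw : S.IsCauchySol 0 0 w)
    (hs : 0 ≤ s) :
    Tendsto w (S.side 1 S.a₂ s) (𝓝 (S.profile w (S.a₂ + S.half) s)) ∧
      Tendsto (S.dx w) (S.side 1 S.a₂ s) (𝓝 (-S.profileDt w (S.a₂ + S.half) s)) := by
  have h₀ := hS.half_pos
  have h₁ := hS.ha
  have := hw.tendsto_side (σ := 1) (a := S.a₂) (h := S.half) (δ := 1) (by norm_num) h₀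
    (by linarith) hs (fun x t ht h1 h2 h3 => by
      exact ⟨Slits.mem_Omega_of_ne ht (by intro e; linarith) (by intro e; linarith),
        hw.charDeriv_one_right hS ht (by linarith)⟩)
  simpa [Slits.profile, Slits.profileDt] using this

theorem Slits.IsCauchySol.tendsto_upper_left (hS : S.Admissible) (hw : S.IsCauchySol 0 0 w)
    (h : S.b₁ + S.ℓ + (S.a₂ - S.a₁) < s) :
    Tendsto w (S.side (-1) S.a₂ s) (𝓝 (S.profile w (S.a₁ + S.half) s)) ∧
      Tendsto (S.dx w) (S.side (-1) S.a₂ s) (𝓝 (S.profileDt w (S.a₁ + S.half) s)) := by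
  have h₀ := hS.half_pos
  have h₁ := hS.ha
  have h₂ := hS.hb₁
  have h₃ := hS.hℓ
  have h₄ := S.a₁_add_half
  have := hw.tendsto_side (σ := -1) (a := S.a₂) (h := S.half) (s := s)
    (δ := s - (S.b₁ + S.ℓ + (S.a₂ - S.a₁))) (by norm_num) h₀
    (by linarith) (by linarith) (fun x t ht h1 h2 h3 => by
      have h3 := abs_lt.1 h3
      exact ⟨Slits.mem_Omega_of_ne ht (by intro e; linarith) (by intro e; linarith),
        hw.charDeriv_neg_mid ht (by linarith) (Or.inr (by linarith))⟩)
  rw [h₄]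
  simpa [Slits.profile, Slits.profileDt, sub_eq_add_neg] using this

/-- Above the lower slit and below the upper one, the left and the middle profile agree. -/
theorem Slits.IsCauchySol.profile_left_eq_mid (hS : S.Admissible) (hw : S.IsCauchySol 0 0 w)
    (h : S.b₁ + S.ℓ < s) (h' : s < S.b₂) :
    S.profile w (S.a₁ - S.half) s = S.profile w (S.a₁ + S.half) s := by
  have h₁ := hS.ha
  have h₂ := hS.hb₁
  have h₃ := hS.hℓ
  have hp : (S.a₁, s) ∈ S.Omega := Slits.mem_Omega.2
    ⟨by linarith, fun e => by linarith [e.2.2], fun e => by linarith [e.1]⟩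
  have hc := (hw.continuousOn.continuousAt (Slits.Dom_mem_nhds hp)).tendsto
  have hs : 0 ≤ s := by linarith
  have n1 := S.side_neBot (σ := 1) (by norm_num) S.a₁ hs
  have n2 := S.side_neBot (σ := -1) (by norm_num) S.a₁ hs
  have e1 := tendsto_nhds_unique (hw.tendsto_lower_right hS hs h').1
    (hc.mono_left (S.side_le_nhds _ _ _))
  have e2 := tendsto_nhds_unique (hw.tendsto_lower_left hS hs).1
    (hc.mono_left (S.side_le_nhds _ _ _))
  rw [e1, e2]

/-- Just below and above the upper slit, the right and the middle profile agree. -/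
theorem Slits.IsCauchySol.profile_right_eq_mid (hS : S.Admissible) (hw : S.IsCauchySol 0 0 w)
    (h : S.b₁ + S.ℓ + (S.a₂ - S.a₁) < s) (h' : s < S.b₂ ∨ S.b₂ + S.ℓ < s) :
    S.profile w (S.a₂ + S.half) s = S.profile w (S.a₁ + S.half) s := by
  have h₁ := hS.ha
  have h₂ := hS.hb₁
  have h₃ := hS.hℓ
  have hp : (S.a₂, s) ∈ S.Omega := Slits.mem_Omega.2
    ⟨by linarith, fun e => by linarith [e.1],
      fun e => by rcases h' with h' | h' <;> linarith [e.2.1, e.2.2]⟩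
  have hc := (hw.continuousOn.continuousAt (Slits.Dom_mem_nhds hp)).tendsto
  have hs : 0 ≤ s := by linarith
  have n1 := S.side_neBot (σ := 1) (by norm_num) S.a₂ hs
  have n2 := S.side_neBot (σ := -1) (by norm_num) S.a₂ hs
  have e1 := tendsto_nhds_unique (hw.tendsto_upper_right hS hs).1
    (hc.mono_left (S.side_le_nhds _ _ _))
  have e2 := tendsto_nhds_unique (hw.tendsto_upper_left hS h).1
    (hc.mono_left (S.side_le_nhds _ _ _))
  rw [e1, e2]

end Profiles

/-! ### The gluing conditions in terms of the profiles -/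

theorem LimEq.eq {F G : ℝ × ℝ → ℝ} {l m : Filter (ℝ × ℝ)} [l.NeBot] [m.NeBot] {x y : ℝ}
    (h : LimEq F l G m) (hx : Tendsto F l (𝓝 x)) (hy : Tendsto G m (𝓝 y)) : x = y := by
  obtain ⟨L, h1, h2⟩ := h
  rw [tendsto_nhds_unique hx h1, tendsto_nhds_unique hy h2]

theorem eq_of_eventuallyEq_nhdsWithin {f g : ℝ → ℝ} {s : ℝ} {T : Set ℝ} [(𝓝[T] s).NeBot]
    (hf : ContinuousAt f s) (hg : ContinuousAt g s) (h : ∀ᶠ x in 𝓝[T] s, f x = g x) :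
    f s = g s :=
  tendsto_nhds_unique (hf.tendsto.mono_left nhdsWithin_le_nhds)
    ((hg.tendsto.mono_left nhdsWithin_le_nhds).congr' (h.mono fun _ hx => hx.symm))

/-- A function differentiable at `s` that vanishes on one side of `s` has a double zero there. -/
theorem hasDerivAt_zero_of_eventuallyEq {f : ℝ → ℝ} {s : ℝ} {T : Set ℝ} [(𝓝[T] s).NeBot]
    (hT : UniqueDiffWithinAt ℝ T s) (hf : DifferentiableAt ℝ f s)
    (h : ∀ᶠ x in 𝓝[T] s, f x = 0) : f s = 0 ∧ HasDerivAt f 0 s := by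
  have h0 : f s = 0 := eq_of_eventuallyEq_nhdsWithin hf.continuousAt continuousAt_const h
  have h1 : HasDerivWithinAt f 0 T s :=
    (hasDerivWithinAt_const s T (0 : ℝ)).congr_of_eventuallyEq h h0
  have h2 : deriv f s = 0 := hT.eq_deriv T hf.hasDerivAt.hasDerivWithinAt h1
  exact ⟨h0, h2 ▸ hf.hasDerivAt⟩

theorem deriv_eq_of_eqOn_Icc {f g : ℝ → ℝ} {g' ℓ t : ℝ} (hℓ : 0 < ℓ) (ht : t ∈ Icc 0 ℓ)
    (hf : DifferentiableAt ℝ f t) (hg : HasDerivAt g g' t) (h : EqOn f g (Icc 0 ℓ)) :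
    deriv f t = g' :=
  (uniqueDiffOn_Icc hℓ t ht).eq_deriv (Icc 0 ℓ) hf.hasDerivAt.hasDerivWithinAt
    (hg.hasDerivWithinAt.congr h (h ht))

section Necessity

variable {S : Slits} {φ ψ : ℝ → ℝ} {w : ℝ × ℝ → ℝ}

/-- The gluing conditions for `w + u^D`, where `w` has zero data, relate the differences `D₁` and
`D₂` to the profiles of `w`. -/
theorem Slits.IsCauchySol.glue_relations (hS : S.Admissible) (hw : S.IsCauchySol 0 0 w)
    (hφ : ContDiff ℝ 2 φ) (hψ : ContDiff ℝ 1 ψ) (hg : S.Glued (fun p => w p + uD φ ψ p))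
    (hg' : S.Glued (fun p => S.dx w p + uDx φ ψ p)) {t : ℝ} (ht : t ∈ Icc 0 S.ℓ) :
    (S.D₁ φ ψ t = S.profile w (S.a₁ - S.half) (S.b₁ + t) -
        S.profile w (S.a₂ + S.half) (S.b₂ + t) ∧
      S.D₁ φ ψ t = S.profile w (S.a₁ + S.half) (S.b₁ + t) -
        S.profile w (S.a₁ + S.half) (S.b₂ + t)) ∧
    S.D₂ φ ψ t = S.profileDt w (S.a₁ - S.half) (S.b₁ + t) +
        S.profileDt w (S.a₂ + S.half) (S.b₂ + t) ∧
      S.D₂ φ ψ t = -(S.profileDt w (S.a₁ + S.half) (S.b₁ + t) +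
        S.profileDt w (S.a₁ + S.half) (S.b₂ + t)) := by
  have h₁ := hS.ha
  have h₂ := hS.hb₁
  have h₃ := hS.hb
  have h₄ := hS.hℓ
  have ht0 := ht.1
  have ht1 := ht.2
  have s1 : 0 ≤ S.b₁ + t := by linarith
  have s2 : 0 ≤ S.b₂ + t := by linarith
  have n1 := S.side_neBot (σ := 1) (by norm_num) S.a₁ s1
  have n2 := S.side_neBot (σ := -1) (by norm_num) S.a₁ s1
  have n3 := S.side_neBot (σ := 1) (by norm_num) S.a₂ s2
  have n4 := S.side_neBot (σ := -1) (by norm_num) S.a₂ s2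
  have c : ∀ σ A B, Tendsto (uD φ ψ) (S.side σ A B) (𝓝 (uD φ ψ (A, B))) := fun σ A B =>
    ((contDiff_uD hφ hψ).continuous.tendsto _).mono_left (S.side_le_nhds σ A B)
  have c' : ∀ σ A B, Tendsto (uDx φ ψ) (S.side σ A B) (𝓝 (uDx φ ψ (A, B))) := fun σ A B =>
    ((contDiff_uDx hφ hψ).continuous.tendsto _).mono_left (S.side_le_nhds σ A B)
  have r1 := hw.tendsto_lower_right hS s1 (by linarith)
  have l1 := hw.tendsto_lower_left hS s1
  have r2 := hw.tendsto_upper_right hS s2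
  have l2 := hw.tendsto_upper_left hS (s := S.b₂ + t) (by linarith)
  have g := hg t ht
  have g' := hg' t ht
  simp only [S.fromLeft_eq_side, S.fromRight_eq_side] at g g'
  have e1 := g.1.eq (l1.1.add (c _ _ _)) (r2.1.add (c _ _ _))
  have e2 := g.2.eq (r1.1.add (c _ _ _)) (l2.1.add (c _ _ _))
  have e3 := g'.1.eq (l1.2.add (c' _ _ _)) (r2.2.add (c' _ _ _))
  have e4 := g'.2.eq (r1.2.add (c' _ _ _)) (l2.2.add (c' _ _ _))
  simp only [Slits.D₁, Slits.D₂]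
  exact ⟨⟨by linarith, by linarith⟩, by linarith, by linarith⟩

/-- The profile in the middle strip has vanishing first and second derivative at the times of
the four tips of the slits: on one side of each of them it is constant. -/
theorem Slits.IsCauchySol.profileDt_mid_tips (hS : S.Admissible) (hw : S.IsCauchySol 0 0 w) :
    ∀ s, (s = S.b₁ ∨ s = S.b₁ + S.ℓ ∨ s = S.b₂ ∨ s = S.b₂ + S.ℓ) →
      S.profileDt w (S.a₁ + S.half) s = 0 ∧ HasDerivAt (S.profileDt w (S.a₁ + S.half)) 0 s := by
  have h₀ := hS.half_pos
  have h₁ := hS.ha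
  have h₂ := hS.hb₁
  have h₃ := hS.hb
  have h₄ := hS.hℓ
  have h₅ := S.a₁_add_half
  have hd : ∀ s, -S.half < s → DifferentiableAt ℝ (S.profileDt w (S.a₁ + S.half)) s := fun s hs =>
    hw.differentiableAt_profileDt (by linarith) (by intro e; linarith) hs
  rintro s (rfl | rfl | rfl | rfl)
  · refine hasDerivAt_zero_of_eventuallyEq (uniqueDiffWithinAt_Iio _) (hd _ (by linarith)) ?_
    filter_upwards [Ioo_mem_nhdsLT (show -S.half < S.b₁ by linarith)] with x hx
    exact hw.profileDt_mid_eq_zero hS hx.1 (Or.inl hx.2)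
  · refine hasDerivAt_zero_of_eventuallyEq (uniqueDiffWithinAt_Ioi _) (hd _ (by linarith)) ?_
    filter_upwards [Ioo_mem_nhdsGT (show S.b₁ + S.ℓ < S.b₂ by linarith)] with x hx
    exact hw.profileDt_mid_eq_zero hS (by linarith [hx.1]) (Or.inr (Or.inl hx))
  · refine hasDerivAt_zero_of_eventuallyEq (uniqueDiffWithinAt_Iio _) (hd _ (by linarith)) ?_
    filter_upwards [Ioo_mem_nhdsLT (show S.b₁ + S.ℓ < S.b₂ by linarith)] with x hx
    exact hw.profileDt_mid_eq_zero hS (by linarith [hx.1]) (Or.inr (Or.inl hx))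
  · refine hasDerivAt_zero_of_eventuallyEq (uniqueDiffWithinAt_Ioi _) (hd _ (by linarith)) ?_
    filter_upwards [self_mem_nhdsWithin] with x (hx : _ < x)
    exact hw.profileDt_mid_eq_zero hS (by linarith) (Or.inr (Or.inr hx))

theorem Slits.IsCauchySol.hasDerivAt_profile_mid (hS : S.Admissible) (hw : S.IsCauchySol φ ψ w)
    {s : ℝ} (hs : -S.half < s) :
    HasDerivAt (S.profile w (S.a₁ + S.half)) (S.profileDt w (S.a₁ + S.half) s) s := by
  have h₀ := hS.half_pos
  have h₅ := S.a₁_add_half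
  exact hw.hasDerivAt_profile (by linarith) (by intro e; linarith) hs

theorem Slits.IsCauchySol.hasDerivAt_profile_left (hS : S.Admissible) (hw : S.IsCauchySol φ ψ w)
    {s : ℝ} (hs : -S.half < s) :
    HasDerivAt (S.profile w (S.a₁ - S.half)) (S.profileDt w (S.a₁ - S.half) s) s := by
  have h₀ := hS.half_pos
  have h₁ := hS.ha
  exact hw.hasDerivAt_profile (by intro e; linarith) (by intro e; linarith) hs

theorem Slits.IsCauchySol.hasDerivAt_profile_right (hS : S.Admissible)
    (hw : S.IsCauchySol φ ψ w) {s : ℝ} (hs : -S.half < s) :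
    HasDerivAt (S.profile w (S.a₂ + S.half)) (S.profileDt w (S.a₂ + S.half) s) s := by
  have h₀ := hS.half_pos
  have h₁ := hS.ha
  exact hw.hasDerivAt_profile (by intro e; linarith) (by intro e; linarith) hs

/-- The values of the three profiles at the times of the tips of the slits: both profiles at the
lower slit start from zero and reach a common value, which is also the starting value of both
profiles at the upper slit; those have a common final value. -/
theorem Slits.IsCauchySol.profile_tips (hS : S.Admissible) (hw : S.IsCauchySol 0 0 w) :
    S.profile w (S.a₁ + S.half) S.b₁ = 0 ∧ S.profile w (S.a₁ - S.half) S.b₁ = 0 ∧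
    S.profile w (S.a₁ - S.half) (S.b₁ + S.ℓ) = S.profile w (S.a₁ + S.half) (S.b₁ + S.ℓ) ∧
    S.profile w (S.a₁ + S.half) S.b₂ = S.profile w (S.a₁ + S.half) (S.b₁ + S.ℓ) ∧
    S.profile w (S.a₂ + S.half) S.b₂ = S.profile w (S.a₁ + S.half) S.b₂ ∧
    S.profile w (S.a₂ + S.half) (S.b₂ + S.ℓ) = S.profile w (S.a₁ + S.half) (S.b₂ + S.ℓ) := by
  have h₀ := hS.half_pos
  have h₁ := hS.ha
  have h₂ := hS.hb₁
  have h₃ := hS.hb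
  have h₄ := hS.hℓ
  have cM : ∀ s, -S.half < s → ContinuousAt (S.profile w (S.a₁ + S.half)) s := fun s hs =>
    (hw.hasDerivAt_profile_mid hS hs).continuousAt
  have cL : ∀ s, -S.half < s → ContinuousAt (S.profile w (S.a₁ - S.half)) s := fun s hs =>
    (hw.hasDerivAt_profile_left hS hs).continuousAt
  have cR : ∀ s, -S.half < s → ContinuousAt (S.profile w (S.a₂ + S.half)) s := fun s hs =>
    (hw.hasDerivAt_profile_right hS hs).continuousAt
  refine ⟨?_, ?_, ?_, ?_, ?_, ?_⟩
  · refine eq_of_eventuallyEq_nhdsWithin (T := Iio S.b₁) (g := fun _ => 0) (cM _ (by linarith))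
      continuousAt_const ?_
    filter_upwards [Ioo_mem_nhdsLT (show -S.half < S.b₁ by linarith)] with x hx
    exact hw.profile_mid_eq_zero hS hx.1 hx.2
  · refine eq_of_eventuallyEq_nhdsWithin (T := Iio S.b₁) (g := fun _ => 0) (cL _ (by linarith))
      continuousAt_const ?_
    filter_upwards [Ioo_mem_nhdsLT (show -S.half < S.b₁ by linarith)] with x hx
    exact hw.profile_left_eq_zero hS hx.1 hx.2
  · refine eq_of_eventuallyEq_nhdsWithin (T := Ioi (S.b₁ + S.ℓ)) (cL _ (by linarith))
      (cM _ (by linarith)) ?_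
    filter_upwards [Ioo_mem_nhdsGT (show S.b₁ + S.ℓ < S.b₂ by linarith)] with x hx
    exact hw.profile_left_eq_mid hS hx.1 hx.2
  · refine constant_of_has_deriv_right_zero (a := S.b₁ + S.ℓ) (b := S.b₂)
      (fun s hs => (cM s (by linarith [hs.1])).continuousWithinAt) (fun s hs => ?_) _
      ⟨by linarith, le_rfl⟩
    have := hw.hasDerivAt_profile_mid hS (s := s) (by linarith [hs.1])
    have h0 : S.profileDt w (S.a₁ + S.half) s = 0 := by
      rcases hs.1.lt_or_eq with h | h
      · exact hw.profileDt_mid_eq_zero hS (by linarith) (Or.inr (Or.inl ⟨h, hs.2⟩))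
      · exact (hw.profileDt_mid_tips hS s (Or.inr (Or.inl h.symm))).1
    rw [h0] at this
    exact this.hasDerivWithinAt
  · refine eq_of_eventuallyEq_nhdsWithin (T := Iio S.b₂) (cR _ (by linarith))
      (cM _ (by linarith)) ?_
    filter_upwards [Ioo_mem_nhdsLT (show S.b₁ + S.ℓ + (S.a₂ - S.a₁) < S.b₂ by linarith)] with x hx
    exact hw.profile_right_eq_mid hS hx.1 (Or.inl hx.2)
  · refine eq_of_eventuallyEq_nhdsWithin (T := Ioi (S.b₂ + S.ℓ)) (cR _ (by linarith))
      (cM _ (by linarith)) ?_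
    filter_upwards [self_mem_nhdsWithin] with x (hx : _ < x)
    exact hw.profile_right_eq_mid hS (by linarith) (Or.inr hx)

/-- The solvability conditions are necessary. -/
theorem Slits.IsCauchySol.solvable (hS : S.Admissible) (hw : S.IsCauchySol 0 0 w)
    (hφ : ContDiff ℝ 2 φ) (hψ : ContDiff ℝ 1 ψ) (hg : S.Glued (fun p => w p + uD φ ψ p))
    (hg' : S.Glued (fun p => S.dx w p + uDx φ ψ p)) : S.Solvable φ ψ := by
  have h₀ := hS.half_pos
  have h₁ := hS.ha
  have h₂ := hS.hb₁
  have h₃ := hS.hb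
  have h₄ := hS.hℓ
  have m0 : (0 : ℝ) ∈ Icc 0 S.ℓ := ⟨le_rfl, h₄.le⟩
  have mℓ : S.ℓ ∈ Icc 0 S.ℓ := ⟨h₄.le, le_rfl⟩
  have rel := fun {t : ℝ} (ht : t ∈ Icc 0 S.ℓ) => hw.glue_relations hS hφ hψ hg hg' ht
  have tips := hw.profileDt_mid_tips hS
  obtain ⟨v1, v2, v3, v4, v5, v6⟩ := hw.profile_tips hS
  have dM : ∀ s, -S.half < s → HasDerivAt (S.profile w (S.a₁ + S.half)) _ s := fun s hs =>
    hw.hasDerivAt_profile_mid hS hs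
  have dD₁ : EqOn (deriv (S.D₁ φ ψ)) (fun t => S.profileDt w (S.a₁ + S.half) (S.b₁ + t) -
      S.profileDt w (S.a₁ + S.half) (S.b₂ + t)) (Icc 0 S.ℓ) := fun t ht =>
    deriv_eq_of_eqOn_Icc h₄ ht (S.hasDerivAt_D₁ hφ hψ t).differentiableAt
      ((dM _ (by linarith [ht.1])).comp_const_add _ _ |>.sub
        ((dM _ (by linarith [ht.1])).comp_const_add _ _)) (fun s hs => (rel hs).1.2)
  have ddD₁ : ∀ t ∈ Icc 0 S.ℓ, HasDerivAt (S.profileDt w (S.a₁ + S.half)) 0 (S.b₁ + t) →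
      HasDerivAt (S.profileDt w (S.a₁ + S.half)) 0 (S.b₂ + t) →
      deriv (deriv (S.D₁ φ ψ)) t = 0 := fun t ht k1 k2 => by
    rw [deriv_eq_of_eqOn_Icc h₄ ht ((S.contDiff_deriv_D₁ hφ hψ).differentiable (by norm_num) t)
      ((k1.comp_const_add _ _).sub (k2.comp_const_add _ _)) dD₁, sub_zero]
  have dD₂ : ∀ t ∈ Icc 0 S.ℓ, HasDerivAt (S.profileDt w (S.a₁ + S.half)) 0 (S.b₁ + t) →
      HasDerivAt (S.profileDt w (S.a₁ + S.half)) 0 (S.b₂ + t) →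
      deriv (S.D₂ φ ψ) t = 0 := fun t ht k1 k2 => by
    rw [deriv_eq_of_eqOn_Icc h₄ ht ((S.contDiff_D₂ hφ hψ).differentiable (by norm_num) t)
      ((k1.comp_const_add _ _).add (k2.comp_const_add _ _)).neg (fun s hs => (rel hs).2.2),
      add_zero, neg_zero]
  have tb1 := tips S.b₁ (by simp)
  have tb1ℓ := tips (S.b₁ + S.ℓ) (by simp)
  have tb2 := tips S.b₂ (by simp)
  have tb2ℓ := tips (S.b₂ + S.ℓ) (by simp)
  -- the integral of `D₂`, computed from the middle profile and from the outer ones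
  have iD₂ : IntervalIntegrable (S.D₂ φ ψ) MeasureTheory.volume 0 S.ℓ :=
    (S.contDiff_D₂ hφ hψ).continuous.intervalIntegrable _ _
  have i1 : ∫ τ in (0 : ℝ)..S.ℓ, S.D₂ φ ψ τ = -S.profile w (S.a₁ + S.half) (S.b₂ + S.ℓ) := by
    have := intervalIntegral.integral_eq_sub_of_hasDerivAt (f := fun t =>
      -(S.profile w (S.a₁ + S.half) (S.b₁ + t) + S.profile w (S.a₁ + S.half) (S.b₂ + t)))
      (fun t ht => by
        rw [uIcc_of_le h₄.le] at ht
        rw [(rel ht).2.2]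
        exact (((dM _ (by linarith [ht.1])).comp_const_add _ _).add
          ((dM _ (by linarith [ht.1])).comp_const_add _ _)).neg) iD₂
    rw [this]
    simp only [add_zero, v1, v4]; ring
  have i2 : ∫ τ in (0 : ℝ)..S.ℓ, S.D₂ φ ψ τ = S.profile w (S.a₁ + S.half) (S.b₂ + S.ℓ) := by
    have := intervalIntegral.integral_eq_sub_of_hasDerivAt (f := fun t =>
      S.profile w (S.a₁ - S.half) (S.b₁ + t) + S.profile w (S.a₂ + S.half) (S.b₂ + t))
      (fun t ht => by
        rw [uIcc_of_le h₄.le] at ht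
        rw [(rel ht).2.1]
        exact ((hw.hasDerivAt_profile_left hS (by linarith [ht.1])).comp_const_add _ _).add
          ((hw.hasDerivAt_profile_right hS (by linarith [ht.1])).comp_const_add _ _)) iD₂
    rw [this]
    simp only [add_zero, v2, v3, v5, v4, v6]; ring
  have r0 := rel m0
  have rℓ := rel mℓ
  simp only [add_zero] at r0
  have d0 := dD₁ m0
  have dℓ := dD₁ mℓ
  simp only [add_zero] at d0
  beta_reduce at dℓ
  exact
    { deriv_D₁_zero := by rw [d0, tb1.1, tb2.1, sub_zero]
      deriv_D₁_ℓ := by rw [dℓ, tb1ℓ.1, tb2ℓ.1, sub_zero]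
      D₁_add := by rw [r0.1.2, rℓ.1.2, v1, v4]; linarith
      deriv2_D₁_zero := ddD₁ 0 m0 (by rw [add_zero]; exact tb1.2) (by rw [add_zero]; exact tb2.2)
      deriv2_D₁_ℓ := ddD₁ _ mℓ tb1ℓ.2 tb2ℓ.2
      integral_D₂ := by linarith
      D₂_zero := by rw [r0.2.2, tb1.1, tb2.1]; norm_num
      D₂_ℓ := by rw [rℓ.2.2, tb1ℓ.1, tb2ℓ.1]; norm_num
      deriv_D₂_zero := dD₂ 0 m0 (by rw [add_zero]; exact tb1.2) (by rw [add_zero]; exact tb2.2)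
      deriv_D₂_ℓ := dD₂ _ mℓ tb1ℓ.2 tb2ℓ.2 }

end Necessity

/-! ### Uniqueness -/

section Uniqueness

variable {S : Slits} {w : ℝ × ℝ → ℝ}

/-- Inside a vertical strip free of slits, `w_t + ε w_x` vanishes identically as soon as it
vanishes on one vertical line. -/
theorem Slits.IsCauchySol.charDeriv_eq_zero_of_column (hw : S.IsCauchySol 0 0 w) {ε c x t : ℝ}
    (hε : ε * ε = 1) (ht : 0 < t) (hc : ∀ s, 0 < s → S.charDeriv ε w (c, s) = 0)
    (hfree : ∀ y ∈ uIcc x c, y ≠ S.a₁ ∧ y ≠ S.a₂) : S.charDeriv ε w (x, t) = 0 := by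
  -- `d` is the signed time needed to travel down from `x` to `c`
  obtain ⟨d, hd⟩ : ∃ d, d = ε * (c - x) := ⟨_, rfl⟩
  have hcx : x + ε * d = c := by rw [hd]; linear_combination (c - x) * hε
  have hxc : c + ε * -d = x := by linear_combination -hcx
  have hΩ : ∀ y s, y ∈ uIcc x c → 0 < s → (y, s) ∈ S.Omega := fun y s hy hs =>
    Slits.mem_Omega_of_ne hs (hfree y hy).1 (hfree y hy).2
  have hmem : ∀ τ, 0 ≤ τ → τ ≤ d → x + ε * τ ∈ uIcc x c := by
    intro τ h0 h1
    rw [mem_uIcc]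
    rcases mul_self_eq_one_iff.1 hε with rfl | rfl
    · left; constructor <;> linarith
    · right; constructor <;> linarith
  have hmem' : ∀ τ, 0 ≤ τ → τ ≤ -d → c + ε * τ ∈ uIcc x c := by
    intro τ h0 h1
    rw [mem_uIcc]
    rcases mul_self_eq_one_iff.1 hε with rfl | rfl
    · right; constructor <;> linarith
    · left; constructor <;> linarith
  rcases le_or_gt 0 d with h0 | h0
  · rcases lt_or_ge d t with h1 | h1
    · have := hw.charDeriv_eq (T := d) hε h0
        (fun τ k0 k1 => hΩ _ (t - τ) (hmem τ k0 k1.le) (by linarith))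
        (S.Omega_subset_Dom (hΩ _ (t - d) (hmem d h0 le_rfl) (by linarith)))
      rw [← this, hcx]
      exact hc _ (by linarith)
    · exact hw.charDeriv_eq_zero hε ht.le
        (fun τ k0 k1 => hΩ _ (t - τ) (hmem τ k0 (by linarith)) (by linarith))
  · have := hw.charDeriv_eq (x := c) (t := t - d) (T := -d) hε (by linarith)
        (fun τ k0 k1 => hΩ _ (t - d - τ) (hmem' τ k0 k1.le) (by linarith))
        (S.Omega_subset_Dom (hΩ _ (t - d - -d) (hmem' (-d) (by linarith) le_rfl) (by linarith)))
    rw [hxc, show t - d - -d = t by ring] at this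
    rw [this]
    exact hc _ (by linarith)

/-- A glued solution with zero Cauchy data vanishes. -/
theorem Slits.IsCauchySol.eq_zero_of_glued (hS : S.Admissible) (hw : S.IsCauchySol 0 0 w)
    (hg : S.Glued w) (hg' : S.Glued (S.dx w)) : ∀ p ∈ S.Dom, w p = 0 := by
  have h₀ := hS.half_pos
  have h₁ := hS.ha
  have h₂ := hS.hb₁
  have h₃ := hS.hb
  have h₄ := hS.hℓ
  have h₅ := S.a₁_add_half
  have hU : uD 0 0 = fun _ => 0 := by funext p; simp [uD]
  have hUx : uDx 0 0 = fun _ => 0 := by funext p; simp [uDx, hU]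
  have rel := fun {t : ℝ} (ht : t ∈ Icc 0 S.ℓ) =>
    hw.glue_relations hS (φ := 0) (ψ := 0) contDiff_const contDiff_const
      (by simpa [hU] using hg) (by simpa [hUx] using hg') ht
  have hD₁ : S.D₁ 0 0 = fun _ => 0 := by funext t; simp [Slits.D₁, hU]
  have hD₂ : S.D₂ 0 0 = fun _ => 0 := by funext t; simp [Slits.D₂, hUx]
  simp only [hD₁, hD₂] at rel
  have hM : ∀ t ∈ Icc 0 S.ℓ, S.profileDt w (S.a₁ + S.half) (S.b₁ + t) = 0 ∧
      S.profileDt w (S.a₁ + S.half) (S.b₂ + t) = 0 := by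
    intro t ht
    have h := deriv_eq_of_eqOn_Icc h₄ ht (differentiableAt_const (0 : ℝ))
      (((hw.hasDerivAt_profile_mid hS (by linarith [ht.1])).comp_const_add S.b₁ t).sub
        ((hw.hasDerivAt_profile_mid hS (by linarith [ht.1])).comp_const_add S.b₂ t))
      (fun s hs => (rel hs).1.2)
    have h' := (rel ht).2.2
    rw [deriv_const] at h
    constructor <;> linarith
  have hO : ∀ t ∈ Icc 0 S.ℓ, S.profileDt w (S.a₁ - S.half) (S.b₁ + t) = 0 ∧
      S.profileDt w (S.a₂ + S.half) (S.b₂ + t) = 0 := by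
    intro t ht
    have h := deriv_eq_of_eqOn_Icc h₄ ht (differentiableAt_const (0 : ℝ))
      (((hw.hasDerivAt_profile_left hS (by linarith [ht.1])).comp_const_add S.b₁ t).sub
        ((hw.hasDerivAt_profile_right hS (by linarith [ht.1])).comp_const_add S.b₂ t))
      (fun s hs => (rel hs).1.1)
    have h' := (rel ht).2.1
    rw [deriv_const] at h
    constructor <;> linarith
  have hMall : ∀ t, 0 < t → S.dt w (S.a₁ + S.half, t) = 0 := by
    intro t ht
    have key : S.profileDt w (S.a₁ + S.half) (t - S.half) = 0 := by
      by_cases k1 : t - S.half ∈ Icc S.b₁ (S.b₁ + S.ℓ)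
      · have := (hM (t - S.half - S.b₁) ⟨by linarith [k1.1], by linarith [k1.2]⟩).1
        rwa [add_sub_cancel] at this
      by_cases k2 : t - S.half ∈ Icc S.b₂ (S.b₂ + S.ℓ)
      · have := (hM (t - S.half - S.b₂) ⟨by linarith [k2.1], by linarith [k2.2]⟩).2
        rwa [add_sub_cancel] at this
      refine hw.profileDt_mid_eq_zero hS (by linarith) ?_
      rw [mem_Icc, not_and_or, not_le, not_le] at k1 k2
      rcases k1 with k1 | k1
      · exact Or.inl k1
      · rcases k2 with k2 | k2
        · exact Or.inr (Or.inl ⟨k1, k2⟩)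
        · exact Or.inr (Or.inr k2)
    rwa [Slits.profileDt, sub_add_cancel] at key
  -- in the middle strip both families of waves vanish
  have colM : ∀ t, 0 < t → S.charDeriv 1 w (S.a₁ + S.half, t) = 0 ∧
      S.charDeriv (-1) w (S.a₁ + S.half, t) = 0 := by
    intro t ht
    have h := hMall t ht
    rw [S.dt_eq_charDeriv] at h
    rcases lt_or_ge (t + (S.a₁ + S.half) - S.a₂) S.b₂ with k | k
    · have := hw.charDeriv_one_mid (x := S.a₁ + S.half) ht (by linarith) (Or.inl k)
      constructor <;> linarith
    · have := hw.charDeriv_neg_mid (x := S.a₁ + S.half) ht (by linarith) (Or.inr (by linarith))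
      constructor <;> linarith
  -- the waves entering the outer strips come from the slits or from the middle strip
  have colL : ∀ t, 0 < t → S.charDeriv 1 w (S.a₁ - S.half, t) = 0 := by
    intro t ht
    have h0 := hw.charDeriv_neg_left hS (x := S.a₁ - S.half) ht (by linarith)
    rcases lt_or_ge (t - S.half) S.b₁ with k1 | k1
    · exact hw.charDeriv_one_left hS ht (Or.inl (by linarith))
    rcases le_or_gt (t - S.half) (S.b₁ + S.ℓ) with k2 | k2
    · have := (hO (t - S.half - S.b₁) ⟨by linarith, by linarith⟩).1
      rw [add_sub_cancel, Slits.profileDt, sub_add_cancel, S.dt_eq_charDeriv] at this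
      linarith
    rcases lt_or_ge (t - S.half) S.b₂ with k3 | k3
    · exact hw.charDeriv_one_left hS ht (Or.inr ⟨by linarith, by linarith⟩)
    have e : S.a₁ - S.half + 1 * (2 * S.half) = S.a₁ + S.half := by ring
    have hΩ : ∀ τ, 0 ≤ τ → τ ≤ 2 * S.half → (S.a₁ - S.half + 1 * τ, t - τ) ∈ S.Omega :=
      fun τ j0 j1 => Slits.mem_Omega.2 ⟨by linarith, fun j => by linarith [j.1, j.2.2],
        fun j => by linarith [j.1]⟩
    have := hw.charDeriv_eq (ε := 1) (x := S.a₁ - S.half) (t := t) (T := 2 * S.half) (by norm_num)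
      (by linarith) (fun τ j0 j1 => hΩ τ j0 j1.le)
      (S.Omega_subset_Dom (hΩ _ (by linarith) le_rfl))
    rw [← this, e]
    exact (colM _ (by linarith)).1
  have colR : ∀ t, 0 < t → S.charDeriv (-1) w (S.a₂ + S.half, t) = 0 := by
    intro t ht
    have h0 := hw.charDeriv_one_right hS (x := S.a₂ + S.half) ht (by linarith)
    rcases lt_or_ge (S.b₂ + S.ℓ) (t - S.half) with k1 | k1
    · exact hw.charDeriv_neg_right hS ht (by linarith)
    rcases le_or_gt S.b₂ (t - S.half) with k2 | k2
    · have := (hO (t - S.half - S.b₂) ⟨by linarith, by linarith⟩).2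
      rw [add_sub_cancel, Slits.profileDt, sub_add_cancel, S.dt_eq_charDeriv] at this
      linarith
    have e : S.a₂ + S.half + -1 * (2 * S.half) = S.a₁ + S.half := by linarith
    have hΩ : ∀ τ, 0 ≤ τ → τ ≤ 2 * S.half → τ < t →
        (S.a₂ + S.half + -1 * τ, t - τ) ∈ S.Omega :=
      fun τ j0 j1 j2 => Slits.mem_Omega.2 ⟨by linarith, fun j => by linarith [j.1],
        fun j => by linarith [j.1, j.2.1]⟩
    rcases lt_or_ge (2 * S.half) t with k3 | k3
    · have := hw.charDeriv_eq (ε := -1) (x := S.a₂ + S.half) (t := t) (T := 2 * S.half)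
        (by norm_num) (by linarith) (fun τ j0 j1 => hΩ τ j0 j1.le (by linarith))
        (S.Omega_subset_Dom (hΩ _ (by linarith) le_rfl k3))
      rw [← this, e]
      exact (colM _ (by linarith)).2
    · exact hw.charDeriv_eq_zero (by norm_num) ht.le fun τ j0 j1 => hΩ τ j0 (by linarith) j1
  have hdt : ∀ x t, 0 < t → x ≠ S.a₁ → x ≠ S.a₂ → S.dt w (x, t) = 0 := by
    intro x t ht k1 k2
    rw [S.dt_eq_charDeriv]
    rcases lt_or_gt_of_ne k1 with j1 | j1
    · rw [hw.charDeriv_neg_left hS ht j1, hw.charDeriv_eq_zero_of_column (by norm_num) ht colL]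
      · norm_num
      · intro y hy
        have : y ≤ max x (S.a₁ - S.half) := hy.2
        have : y < S.a₁ := this.trans_lt (max_lt j1 (by linarith))
        exact ⟨this.ne, (this.trans h₁).ne⟩
    rcases lt_or_gt_of_ne k2 with j2 | j2
    · have hfree : ∀ y ∈ uIcc x (S.a₁ + S.half), y ≠ S.a₁ ∧ y ≠ S.a₂ := by
        intro y hy
        have u1 : y ≤ max x (S.a₁ + S.half) := hy.2
        have u2 : min x (S.a₁ + S.half) ≤ y := hy.1
        exact ⟨((lt_min j1 (by linarith)).trans_le u2).ne',
          (u1.trans_lt (max_lt j2 (by linarith))).ne⟩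
      rw [hw.charDeriv_eq_zero_of_column (by norm_num) ht (fun s hs => (colM s hs).1) hfree,
        hw.charDeriv_eq_zero_of_column (by norm_num) ht (fun s hs => (colM s hs).2) hfree]
      norm_num
    · rw [hw.charDeriv_one_right hS ht j2, hw.charDeriv_eq_zero_of_column (by norm_num) ht colR]
      · norm_num
      · intro y hy
        have : min x (S.a₂ + S.half) ≤ y := hy.1
        have : S.a₂ < y := (lt_min j2 (by linarith)).trans_le this
        exact ⟨(h₁.trans this).ne', this.ne'⟩
  have hoff : ∀ x t, 0 ≤ t → x ≠ S.a₁ → x ≠ S.a₂ → w (x, t) = 0 := fun x t ht k1 k2 =>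
    hw.eq_zero_of_dt_eq_zero ht k1 k2 fun s hs _ => hdt x s hs k1 k2
  -- the lines carrying the slits are reached by continuity
  rintro ⟨x, t⟩ hp
  have ht : 0 ≤ t := Slits.snd_nonneg_of_mem_Dom hp
  have hne := S.side_neBot (σ := 1) (by norm_num) x ht
  have hle : S.side 1 x t ≤ 𝓝[S.Dom] (x, t) := nhdsWithin_mono _ inter_subset_left
  refine tendsto_nhds_unique ((hw.continuousOn _ hp).mono_left hle) ?_
  refine tendsto_const_nhds.congr' ?_
  have near : ∀ a : ℝ, ∀ᶠ p : ℝ × ℝ in S.side 1 x t, p.1 ≠ a := by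
    intro a
    rcases eq_or_ne x a with rfl | hxa
    · filter_upwards [self_mem_nhdsWithin] with p hp' e
      have := hp'.2
      simp only [mem_ofPred_eq, e] at this
      linarith
    · exact (continuous_fst.continuousAt.eventually_ne (x := (x, t)) hxa).filter_mono
        (S.side_le_nhds _ _ _)
  filter_upwards [near S.a₁, near S.a₂, S.Dom_mem_side 1 x t] with p p1 p2 p3
  exact (hoff p.1 p.2 (Slits.snd_nonneg_of_mem_Dom p3) p1 p2).symm

end Uniqueness

/-! ### Truncation to the time interval of a slit -/

/-- `f` vanishes outside the open interval `(0, ℓ)`. -/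
def VanishesOff (ℓ : ℝ) (f : ℝ → ℝ) : Prop := ∀ s, s ≤ 0 ∨ ℓ ≤ s → f s = 0

/-- The truncation of `g` to the open interval `(0, ℓ)`. -/
def truncation (ℓ : ℝ) (g : ℝ → ℝ) (t : ℝ) : ℝ := heaviside t * heaviside (ℓ - t) * g t

theorem vanishesOff_truncation (ℓ : ℝ) (g : ℝ → ℝ) : VanishesOff ℓ (truncation ℓ g) := by
  rintro s (hs | hs)
  · simp [truncation, heaviside, not_lt.2 hs]
  · simp [truncation, heaviside, hs]

theorem VanishesOff.const_mul {ℓ : ℝ} {f : ℝ → ℝ} (h : VanishesOff ℓ f) (c : ℝ) :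
    VanishesOff ℓ (fun s => c * f s) := fun s hs => by simp [h s hs]

theorem truncation_eq {ℓ : ℝ} {g : ℝ → ℝ} (h0 : g 0 = 0) (h1 : g ℓ = 0) {t : ℝ}
    (ht : t ∈ Icc 0 ℓ) : truncation ℓ g t = g t := by
  rcases ht.1.lt_or_eq with h2 | rfl
  · rcases ht.2.lt_or_eq with h3 | rfl
    · simp [truncation, heaviside, h2, h3]
    · simp [truncation, h1]
  · simp [truncation, h0]

theorem eventually_heaviside_eq {t : ℝ} (ht : t ≠ 0) :
    ∀ᶠ s in 𝓝 t, heaviside s = heaviside t := by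
  rcases lt_or_gt_of_ne ht with h | h
  · filter_upwards [Iio_mem_nhds h] with s (hs : s < 0)
    simp [heaviside, not_lt.2 hs.le, not_lt.2 h.le]
  · filter_upwards [Ioi_mem_nhds h] with s (hs : 0 < s)
    simp [heaviside, hs, h]

theorem truncation_eventuallyEq {ℓ t : ℝ} (g : ℝ → ℝ) (h0 : t ≠ 0) (h1 : t ≠ ℓ) :
    truncation ℓ g =ᶠ[𝓝 t] fun s => heaviside t * heaviside (ℓ - t) * g s := by
  have hc : Tendsto (fun s : ℝ => ℓ - s) (𝓝 t) (𝓝 (ℓ - t)) :=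
    (continuous_const.sub continuous_id).tendsto t
  filter_upwards [eventually_heaviside_eq h0,
    hc.eventually (eventually_heaviside_eq (sub_ne_zero.2 h1.symm))] with s hs1 hs2
  rw [truncation, hs1, hs2]

theorem abs_truncation_le (ℓ : ℝ) (g : ℝ → ℝ) (t : ℝ) : |truncation ℓ g t| ≤ |g t| := by
  have h : ∀ s, |heaviside s| ≤ 1 := by
    intro s; simp only [heaviside]; split_ifs <;> simp
  rw [truncation, abs_mul, abs_mul]
  calc |heaviside t| * |heaviside (ℓ - t)| * |g t| ≤ 1 * 1 * |g t| := by
        gcongr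
        · exact h t
        · exact h (ℓ - t)
    _ = |g t| := by ring

theorem continuous_truncation {ℓ : ℝ} {g : ℝ → ℝ} (hg : Continuous g) (h0 : g 0 = 0)
    (h1 : g ℓ = 0) : Continuous (truncation ℓ g) := by
  have key : ∀ t, g t = 0 → ContinuousAt (truncation ℓ g) t := by
    intro t ht
    have : Tendsto (fun s => |g s|) (𝓝 t) (𝓝 0) := by
      have := (hg.abs.tendsto t)
      rwa [ht, abs_zero] at this
    have h2 : truncation ℓ g t = 0 := by simp [truncation, ht]
    rw [ContinuousAt, h2]
    exact squeeze_zero_norm (fun s => abs_truncation_le ℓ g s) this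
  refine continuous_iff_continuousAt.2 fun t => ?_
  by_cases c0 : t = 0
  · exact key t (c0 ▸ h0)
  by_cases c1 : t = ℓ
  · exact key t (c1 ▸ h1)
  exact (hg.const_mul _).continuousAt.congr (truncation_eventuallyEq g c0 c1).symm

/-- A function with double zeros at both ends of the interval can be truncated without loss of
differentiability. -/
theorem hasDerivAt_truncation {ℓ : ℝ} {g g' : ℝ → ℝ} (hg : ∀ t, HasDerivAt g (g' t) t)
    (h0 : g 0 = 0) (h1 : g ℓ = 0) (h0' : g' 0 = 0) (h1' : g' ℓ = 0) (t : ℝ) :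
    HasDerivAt (truncation ℓ g) (truncation ℓ g' t) t := by
  have key : ∀ t, g t = 0 → g' t = 0 → HasDerivAt (truncation ℓ g) (truncation ℓ g' t) t := by
    intro t ht ht'
    have h2 : truncation ℓ g t = 0 := by simp [truncation, ht]
    have h3 : truncation ℓ g' t = 0 := by simp [truncation, ht']
    have h4 := hasDerivAt_iff_isLittleO.1 (hg t)
    rw [hasDerivAt_iff_isLittleO, h2, h3]
    simp only [ht, ht', smul_zero, sub_zero] at h4 ⊢
    exact (Asymptotics.isBigO_of_le _ fun s => abs_truncation_le ℓ g s).trans_isLittleO h4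
  by_cases c0 : t = 0
  · exact key t (c0 ▸ h0) (c0 ▸ h0')
  by_cases c1 : t = ℓ
  · exact key t (c1 ▸ h1) (c1 ▸ h1')
  exact ((hg t).const_mul _).congr_of_eventuallyEq (truncation_eventuallyEq g c0 c1)

/-! ### Outgoing waves -/

/-- The wave emitted by a slit on the line `x = 0`: it equals `(A + B)(t - x)` to the right of
that line and `(A - B)(t + x)` to the left. -/
def outgoing (A B : ℝ → ℝ) (p : ℝ × ℝ) : ℝ :=
  A (p.2 - |p.1|) + Real.sign p.1 * B (p.2 - |p.1|)

/-- The plane without the open slit `x = 0`, `0 < t < ℓ`; the tips belong to the set. -/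
def offSlit (ℓ : ℝ) : Set (ℝ × ℝ) := {p | p.1 ≠ 0 ∨ p.2 ≤ 0 ∨ ℓ ≤ p.2}

theorem abs_sign_le_one (x : ℝ) : |Real.sign x| ≤ 1 := by
  rcases Real.sign_apply_eq x with h | h | h <;> simp [h]

theorem outgoing_eventuallyEq_of_pos (A B : ℝ → ℝ) {p : ℝ × ℝ} (h : 0 < p.1) :
    outgoing A B =ᶠ[𝓝 p] fun q => (fun _ => 0) (q.1 + q.2) + (fun s => A (-s) + B (-s))
      (q.1 - q.2) := by
  filter_upwards [continuous_fst.continuousAt.eventually_const_lt h] with q hq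
  simp [outgoing, abs_of_pos hq, Real.sign_of_pos hq]

theorem outgoing_eventuallyEq_of_neg (A B : ℝ → ℝ) {p : ℝ × ℝ} (h : p.1 < 0) :
    outgoing A B =ᶠ[𝓝 p] fun q => (fun s => A s - B s) (q.1 + q.2) + (fun _ => 0) (q.1 - q.2) := by
  filter_upwards [continuous_fst.continuousAt.eventually_lt_const h] with q hq
  simp [outgoing, abs_of_neg hq, Real.sign_of_neg hq, add_comm]
  ring

theorem continuousAt_outgoing {ℓ : ℝ} {A B : ℝ → ℝ} (hA : Continuous A) (hB : Continuous B)
    (hB0 : VanishesOff ℓ B) {p : ℝ × ℝ} (hp : p ∈ offSlit ℓ) :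
    ContinuousAt (outgoing A B) p := by
  rcases lt_trichotomy p.1 0 with h | h | h
  · refine ContinuousAt.congr ?_ (outgoing_eventuallyEq_of_neg A B h).symm
    exact Continuous.continuousAt (by fun_prop)
  · have hB1 : B p.2 = 0 := hB0 _ (hp.resolve_left (not_not.2 h))
    have c : Continuous fun q : ℝ × ℝ => q.2 - |q.1| := by fun_prop
    have e : outgoing A B p = A (p.2 - |p.1|) + 0 := by simp [outgoing, h]
    rw [ContinuousAt, e]
    refine ((hA.comp c).tendsto p).add ?_
    have : Tendsto (fun q : ℝ × ℝ => |B (q.2 - |q.1|)|) (𝓝 p) (𝓝 0) := by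
      have := (hB.comp c).abs.tendsto p
      simpa [h, hB1] using this
    refine squeeze_zero_norm (fun q => ?_) this
    rw [Real.norm_eq_abs, abs_mul]
    exact mul_le_of_le_one_left (abs_nonneg _) (abs_sign_le_one _)
  · refine ContinuousAt.congr ?_ (outgoing_eventuallyEq_of_pos A B h).symm
    exact Continuous.continuousAt (by fun_prop)

/-- Outgoing waves are closed under partial derivatives: `(A, B)` becomes `(-B', -A')` under the
`x`-derivative and `(A', B')` under the `t`-derivative, also on the line `x = 0` off the open
slit. -/
theorem hasFDerivAt_outgoing {ℓ : ℝ} {A B A' B' : ℝ → ℝ} (hA : ∀ s, HasDerivAt A (A' s) s)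
    (hB : ∀ s, HasDerivAt B (B' s) s) (hA0 : VanishesOff ℓ A') (hB0 : VanishesOff ℓ B)
    (hB0' : VanishesOff ℓ B') {p : ℝ × ℝ} (hp : p ∈ offSlit ℓ) :
    HasFDerivAt (outgoing A B)
      (covec (outgoing (fun s => -B' s) (fun s => -A' s) p) (outgoing A' B' p)) p := by
  rcases lt_trichotomy p.1 0 with h | h | h
  · refine HasFDerivAt.congr_of_eventuallyEq ?_ (outgoing_eventuallyEq_of_neg A B h)
    refine (hasFDerivAt_dAlembert ((hA _).sub (hB _)) (hasDerivAt_const _ _)).congr_fderiv ?_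
    simp only [outgoing, abs_of_neg h, Real.sign_of_neg h]
    congr 1 <;> ring_nf
  · have hs := hp.resolve_left (not_not.2 h)
    have hA1 : A' p.2 = 0 := hA0 _ hs
    have hB1 : B p.2 = 0 := hB0 _ hs
    have hB2 : B' p.2 = 0 := hB0' _ hs
    have e1 : covec (outgoing (fun s => -B' s) (fun s => -A' s) p) (outgoing A' B' p) = 0 := by
      ext <;> simp [outgoing, h, hA1, hB2]
    rw [e1, hasFDerivAt_iff_isLittleO]
    have c : Tendsto (fun q : ℝ × ℝ => q.2 - |q.1|) (𝓝 p) (𝓝 p.2) := by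
      have : Continuous fun q : ℝ × ℝ => q.2 - |q.1| := by fun_prop
      simpa [h] using this.tendsto p
    -- `q ↦ q.2 - |q.1|` is Lipschitz
    have hbig : (fun q : ℝ × ℝ => q.2 - |q.1| - p.2) =O[𝓝 p] fun q => q - p := by
      refine Asymptotics.IsBigO.of_bound 2 (Eventually.of_forall fun q => ?_)
      have h1 : |q.1| ≤ ‖q - p‖ := by
        have := norm_fst_le (q - p)
        simpa [h] using this
      have h2 : |q.2 - p.2| ≤ ‖q - p‖ := by
        have := norm_snd_le (q - p)
        simpa using this
      rw [Real.norm_eq_abs]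
      have h3 := abs_le.1 h2
      exact abs_le.2 ⟨by linarith, by linarith [abs_nonneg q.1]⟩
    have kA := (hasDerivAt_iff_isLittleO.1 (hA p.2)).comp_tendsto c
    have kB := (hasDerivAt_iff_isLittleO.1 (hB p.2)).comp_tendsto c
    have oA := kA.trans_isBigO hbig
    have oB := kB.trans_isBigO hbig
    simp only [Function.comp_def, hA1, hB1, hB2, smul_zero, sub_zero] at oA oB
    have oB' : (fun q : ℝ × ℝ => Real.sign q.1 * B (q.2 - |q.1|)) =o[𝓝 p] fun q => q - p := by
      refine (Asymptotics.isBigO_of_le _ fun q => ?_).trans_isLittleO oB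
      rw [Real.norm_eq_abs, abs_mul]
      exact mul_le_of_le_one_left (abs_nonneg _) (abs_sign_le_one _)
    refine (oA.add oB').congr_left fun q => ?_
    simp [outgoing, h]
    ring
  · refine HasFDerivAt.congr_of_eventuallyEq ?_ (outgoing_eventuallyEq_of_pos A B h)
    have n : ∀ {f : ℝ → ℝ} {f' x : ℝ}, HasDerivAt f f' (-x) → HasDerivAt (fun s => f (-s)) (-f') x :=
      fun {f f' x} hf => (hf.comp x (hasDerivAt_neg x)).congr_deriv (by simp)
    refine (hasFDerivAt_dAlembert (hasDerivAt_const _ _) ((n (hA _)).add (n (hB _)))).congr_fderiv ?_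
    simp only [outgoing, abs_of_pos h, Real.sign_of_pos h]
    congr 1 <;> ring_nf

theorem tendsto_outgoing_side {A B : ℝ → ℝ} (hA : Continuous A) (hB : Continuous B) {σ t : ℝ}
    (hσ : σ * σ = 1) {l : Filter (ℝ × ℝ)} (hl : l ≤ 𝓝 (0, t)) (hl' : ∀ᶠ p in l, 0 < σ * p.1) :
    Tendsto (outgoing A B) l (𝓝 (A t + σ * B t)) := by
  have c : Continuous fun q : ℝ × ℝ => A (q.2 - |q.1|) + σ * B (q.2 - |q.1|) := by fun_prop
  have h := (c.tendsto (0, t)).mono_left hl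
  simp only [abs_zero, sub_zero] at h
  refine h.congr' ?_
  filter_upwards [hl'] with q hq
  have : Real.sign q.1 = σ := by
    rcases mul_self_eq_one_iff.1 hσ with rfl | rfl
    · exact Real.sign_of_pos (by linarith)
    · exact Real.sign_of_neg (by linarith)
  rw [outgoing, this]

/-! ### The waves emitted by the two slits -/

section SlitWaves

variable {S : Slits} {A B A' B' A'' B'' : ℝ → ℝ}

/-- The wave emitted by the upper slit minus the same wave emitted by the lower slit. -/
def Slits.slitWaves (S : Slits) (A B : ℝ → ℝ) (p : ℝ × ℝ) : ℝ :=
  outgoing A B (p.1 - S.a₂, p.2 - S.b₂) - outgoing A B (p.1 - S.a₁, p.2 - S.b₁)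

theorem Slits.Admissible.mem_offSlit (hS : S.Admissible) {p : ℝ × ℝ} (hp : p ∈ S.Dom) :
    (p.1 - S.a₁, p.2 - S.b₁) ∈ offSlit S.ℓ ∧ (p.1 - S.a₂, p.2 - S.b₂) ∈ offSlit S.ℓ := by
  obtain ⟨x, t⟩ := p
  have h₁ := hS.ha
  have h₂ := hS.hb₁
  have h₃ := hS.hb
  have h₄ := hS.hℓ
  simp only [offSlit, mem_ofPred_eq]
  rcases hp with hp | hp
  · obtain ⟨-, k1, k2⟩ := Slits.mem_Omega.1 hp
    constructor
    · by_contra! hc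
      exact k1 ⟨by linarith [hc.1], by linarith [hc.2.1], by linarith [hc.2.2]⟩
    · by_contra! hc
      exact k2 ⟨by linarith [hc.1], by linarith [hc.2.1], by linarith [hc.2.2]⟩
  · obtain rfl : t = 0 := hp
    exact ⟨Or.inr (Or.inl (by linarith)), Or.inr (Or.inl (by linarith))⟩

theorem Slits.Admissible.continuousOn_slitWaves (hS : S.Admissible) (hA : Continuous A)
    (hB : Continuous B) (hB0 : VanishesOff S.ℓ B) : ContinuousOn (S.slitWaves A B) S.Dom := by
  intro p hp
  obtain ⟨k1, k2⟩ := hS.mem_offSlit hp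
  have sh : ∀ a b : ℝ, ContinuousAt (fun q : ℝ × ℝ => (q.1 - a, q.2 - b)) p := fun a b =>
    Continuous.continuousAt (by fun_prop)
  exact (((continuousAt_outgoing hA hB hB0 k2).comp_of_eq (sh S.a₂ S.b₂) rfl).sub
    ((continuousAt_outgoing hA hB hB0 k1).comp_of_eq (sh S.a₁ S.b₁) rfl)).continuousWithinAt

theorem Slits.Admissible.hasFDerivAt_slitWaves (hS : S.Admissible)
    (hA : ∀ s, HasDerivAt A (A' s) s) (hB : ∀ s, HasDerivAt B (B' s) s)
    (hA0 : VanishesOff S.ℓ A') (hB0 : VanishesOff S.ℓ B) (hB0' : VanishesOff S.ℓ B')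
    {p : ℝ × ℝ} (hp : p ∈ S.Dom) :
    HasFDerivAt (S.slitWaves A B) (covec (S.slitWaves (fun s => -B' s) (fun s => -A' s) p)
      (S.slitWaves A' B' p)) p := by
  obtain ⟨k1, k2⟩ := hS.mem_offSlit hp
  have sh : ∀ a b : ℝ, HasFDerivAt (fun q : ℝ × ℝ => (q.1 - a, q.2 - b))
      (ContinuousLinearMap.id ℝ (ℝ × ℝ)) p := fun a b => (hasFDerivAt_id p).sub_const (a, b)
  have d1 := (hasFDerivAt_outgoing hA hB hA0 hB0 hB0' k1).comp p (sh S.a₁ S.b₁)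
  have d2 := (hasFDerivAt_outgoing hA hB hA0 hB0 hB0' k2).comp p (sh S.a₂ S.b₂)
  refine (d2.sub d1).congr_fderiv ?_
  ext <;> simp [Slits.slitWaves]

/-- Gain of one order of smoothness from the partial derivatives. -/
theorem Slits.contDiffOn_succ_of_covec {f fx ft : ℝ × ℝ → ℝ} {n : ℕ}
    (h : ∀ p ∈ S.Dom, HasFDerivAt f (covec (fx p) (ft p)) p) (hx : ContDiffOn ℝ n fx S.Dom)
    (ht : ContDiffOn ℝ n ft S.Dom) : ContDiffOn ℝ (n + 1) f S.Dom := by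
  rw [contDiffOn_succ_iff_hasFDerivWithinAt_of_uniqueDiffOn S.uniqueDiffOn_Dom]
  exact ⟨by simp, fun p => covec (fx p) (ft p),
    (hx.smul contDiffOn_const).add (ht.smul contDiffOn_const),
    fun p hp => (h p hp).hasFDerivWithinAt⟩

theorem Slits.Admissible.contDiffOn_one_slitWaves (hS : S.Admissible)
    (hA : ∀ s, HasDerivAt A (A' s) s) (hB : ∀ s, HasDerivAt B (B' s) s)
    (hA0 : VanishesOff S.ℓ A') (hB0 : VanishesOff S.ℓ B) (hB0' : VanishesOff S.ℓ B')
    (hAc : Continuous A') (hBc : Continuous B') : ContDiffOn ℝ 1 (S.slitWaves A B) S.Dom := by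
  have := Slits.contDiffOn_succ_of_covec (n := 0)
    (fun p hp => hS.hasFDerivAt_slitWaves hA hB hA0 hB0 hB0' hp)
    (contDiffOn_zero.2 (hS.continuousOn_slitWaves hBc.neg hAc.neg
      (fun s hs => by simp [hA0 s hs])))
    (contDiffOn_zero.2 (hS.continuousOn_slitWaves hAc hBc hB0'))
  simpa using this

/-- Pulses `A`, `B` of class `C²` that are switched on smoothly emit a classical solution of the
wave equation with zero Cauchy data. -/
theorem Slits.Admissible.isCauchySol_slitWaves (hS : S.Admissible)
    (hA : ∀ s, HasDerivAt A (A' s) s) (hB : ∀ s, HasDerivAt B (B' s) s)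
    (hA' : ∀ s, HasDerivAt A' (A'' s) s) (hB' : ∀ s, HasDerivAt B' (B'' s) s)
    (hAc : Continuous A'') (hBc : Continuous B'') (hAneg : ∀ s ≤ 0, A s = 0)
    (hA0 : VanishesOff S.ℓ A') (hB0 : VanishesOff S.ℓ B) (hB0' : VanishesOff S.ℓ B')
    (hA0'' : VanishesOff S.ℓ A'') (hB0'' : VanishesOff S.ℓ B'') :
    S.IsCauchySol 0 0 (S.slitWaves A B) := by
  have neg : ∀ {f : ℝ → ℝ}, VanishesOff S.ℓ f → VanishesOff S.ℓ (fun s => -f s) :=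
    fun hf s hs => by simp [hf s hs]
  have dneg : ∀ {f f' : ℝ → ℝ}, (∀ s, HasDerivAt f (f' s) s) →
      ∀ s, HasDerivAt (fun s => -f s) ((fun s => -f' s) s) s := fun hf s => (hf s).neg
  have d := fun {p : ℝ × ℝ} (hp : p ∈ S.Dom) =>
    hS.hasFDerivAt_slitWaves hA hB hA0 hB0 hB0' hp
  have dt' := fun {p : ℝ × ℝ} (hp : p ∈ S.Dom) =>
    hS.hasFDerivAt_slitWaves hA' hB' hA0'' hB0' hB0'' hp
  have dx' := fun {p : ℝ × ℝ} (hp : p ∈ S.Dom) =>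
    hS.hasFDerivAt_slitWaves (dneg hB') (dneg hA') (neg hB0'') (neg hA0) (neg hA0'') hp
  have edx : EqOn (S.dx (S.slitWaves A B)) (S.slitWaves (fun s => -B' s) (fun s => -A' s)) S.Dom :=
    fun p hp => Slits.dx_eq_of_hasFDerivWithinAt hp (d hp).hasFDerivWithinAt
  have edt : EqOn (S.dt (S.slitWaves A B)) (S.slitWaves A' B') S.Dom :=
    fun p hp => Slits.dt_eq_of_hasFDerivWithinAt hp (d hp).hasFDerivWithinAt
  have c2 : ContDiffOn ℝ 2 (S.slitWaves A B) S.Dom := by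
    have := Slits.contDiffOn_succ_of_covec (n := 1) (fun p hp => d hp)
      (hS.contDiffOn_one_slitWaves (dneg hB') (dneg hA') (neg hB0'') (neg hA0) (neg hA0'')
        hBc.neg hAc.neg)
      (hS.contDiffOn_one_slitWaves hA' hB' hA0'' hB0' hB0'' hAc hBc)
    simpa [one_add_one_eq_two] using this
  -- before the waves are emitted the retarded time is not positive
  have zero : ∀ {f g : ℝ → ℝ}, (∀ s ≤ 0, f s = 0) → VanishesOff S.ℓ g → ∀ x,
      S.slitWaves f g (x, 0) = 0 := by
    intro f g hf hg x
    have h₁ := hS.ha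
    have h₂ := hS.hb₁
    have h₃ := hS.hb
    have h₄ := hS.hℓ
    have s1 : 0 - S.b₁ - |x - S.a₁| ≤ 0 := by linarith [abs_nonneg (x - S.a₁)]
    have s2 : 0 - S.b₂ - |x - S.a₂| ≤ 0 := by linarith [abs_nonneg (x - S.a₂)]
    simp only [Slits.slitWaves, outgoing]
    rw [hf _ s1, hf _ s2, hg _ (Or.inl s1), hg _ (Or.inl s2)]
    simp
  exact
    { contDiff_two := c2.mono S.Omega_subset_Dom
      contDiff_one := c2.of_le (by norm_num)
      wave := fun p hp => by
        have hp' := S.Omega_subset_Dom hp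
        have e1 : S.dt (S.dt (S.slitWaves A B)) p = S.slitWaves A'' B'' p := by
          rw [← Slits.dt_eq_of_hasFDerivWithinAt hp' (dt' hp').hasFDerivWithinAt]
          simp only [Slits.dt] at edt ⊢
          rw [fderivWithin_congr edt (edt hp')]
        have e2 : S.dx (S.dx (S.slitWaves A B)) p = S.slitWaves A'' B'' p := by
          have h := Slits.dx_eq_of_hasFDerivWithinAt hp' (dx' hp').hasFDerivWithinAt
          simp only [neg_neg] at h
          rw [← h]
          simp only [Slits.dx] at edx ⊢
          rw [fderivWithin_congr edx (edx hp')]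
        rw [e1, e2, sub_self]
      init := zero hAneg hB0
      init_dt := fun x => by
        rw [edt (S.mem_Dom_zero x)]
        exact zero (fun s hs => hA0 s (Or.inl hs)) hB0' x }

theorem Slits.tendsto_shift_side (S : Slits) (σ X Y a b : ℝ) :
    Tendsto (fun p : ℝ × ℝ => (p.1 - a, p.2 - b)) (S.side σ X Y) (𝓝 (X - a, Y - b)) := by
  have c : Continuous fun p : ℝ × ℝ => (p.1 - a, p.2 - b) := by fun_prop
  exact (c.tendsto (X, Y)).mono_left (S.side_le_nhds σ X Y)

theorem Slits.tendsto_outgoing_shift_side (S : Slits) (hA : Continuous A) (hB : Continuous B)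
    {σ a b t : ℝ} (hσ : σ * σ = 1) :
    Tendsto (fun p : ℝ × ℝ => outgoing A B (p.1 - a, p.2 - b)) (S.side σ a (b + t))
      (𝓝 (A t + σ * B t)) := by
  have hm := S.tendsto_shift_side σ a (b + t) a b
  rw [sub_self, add_sub_cancel_left] at hm
  refine tendsto_map'_iff.1 (tendsto_outgoing_side hA hB hσ hm ?_)
  rw [eventually_map]
  filter_upwards [self_mem_nhdsWithin] with p hp using hp.2

/-- The traces of the emitted waves on the lower slit, which the wave of the upper slit does not
reach. -/
theorem Slits.Admissible.tendsto_slitWaves_lower (hS : S.Admissible) (hA : Continuous A)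
    (hB : Continuous B) (hAneg : ∀ s ≤ 0, A s = 0) (hB0 : VanishesOff S.ℓ B) {σ t : ℝ}
    (hσ : σ * σ = 1) (ht : t ∈ Icc 0 S.ℓ) :
    Tendsto (S.slitWaves A B) (S.side σ S.a₁ (S.b₁ + t)) (𝓝 (-(A t + σ * B t))) := by
  have h₁ := hS.ha
  have h₂ := hS.hb₁
  have h₃ := hS.hb
  have h1 := S.tendsto_outgoing_shift_side hA hB (a := S.a₁) (b := S.b₁) (t := t) hσ
  have h2 := (continuousAt_outgoing hA hB hB0 (p := (S.a₁ - S.a₂, S.b₁ + t - S.b₂))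
    (Or.inl (sub_ne_zero.2 h₁.ne))).tendsto.comp
      (S.tendsto_shift_side σ S.a₁ (S.b₁ + t) S.a₂ S.b₂)
  have e : outgoing A B (S.a₁ - S.a₂, S.b₁ + t - S.b₂) = 0 := by
    have s : S.b₁ + t - S.b₂ - |S.a₁ - S.a₂| ≤ 0 := by
      linarith [abs_nonneg (S.a₁ - S.a₂), ht.2]
    simp [outgoing, hAneg _ s, hB0 _ (Or.inl s)]
  rw [e] at h2
  rw [← zero_sub]
  exact h2.sub h1

/-- The traces of the emitted waves on the upper slit, which the wave of the lower slit has left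
behind in its final state. -/
theorem Slits.Admissible.tendsto_slitWaves_upper (hS : S.Admissible) (hA : Continuous A)
    (hB : Continuous B) (hAℓ : ∀ s, S.ℓ ≤ s → A s = A S.ℓ) (hB0 : VanishesOff S.ℓ B) {σ t : ℝ}
    (hσ : σ * σ = 1) (ht : t ∈ Icc 0 S.ℓ) :
    Tendsto (S.slitWaves A B) (S.side σ S.a₂ (S.b₂ + t)) (𝓝 (A t + σ * B t - A S.ℓ)) := by
  have h₁ := hS.ha
  have h₂ := hS.hb₁
  have h₃ := hS.hb
  have h1 := S.tendsto_outgoing_shift_side hA hB (a := S.a₂) (b := S.b₂) (t := t) hσ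
  have h2 := (continuousAt_outgoing hA hB hB0 (p := (S.a₂ - S.a₁, S.b₂ + t - S.b₁))
    (Or.inl (sub_ne_zero.2 h₁.ne'))).tendsto.comp
      (S.tendsto_shift_side σ S.a₂ (S.b₂ + t) S.a₁ S.b₁)
  have e : outgoing A B (S.a₂ - S.a₁, S.b₂ + t - S.b₁) = A S.ℓ := by
    have s : S.ℓ ≤ S.b₂ + t - S.b₁ - |S.a₂ - S.a₁| := by
      rw [abs_of_pos (sub_pos.2 h₁)]; linarith [ht.1]
    simp [outgoing, hAℓ _ s, hB0 _ (Or.inr s)]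
  rw [e] at h2
  exact h1.sub h2

end SlitWaves

/-! ### The explicit solution -/

section Solution

variable {S : Slits} {φ ψ : ℝ → ℝ}

theorem Slits.omega_eq_truncation (S : Slits) (hφ : ContDiff ℝ 2 φ) (hψ : ContDiff ℝ 1 ψ) :
    S.omega φ ψ = truncation S.ℓ (deriv (S.D₁ φ ψ)) := by
  rw [S.deriv_D₁_eq hφ hψ]; rfl

theorem Slits.nu_eq_truncation (S : Slits) (φ ψ : ℝ → ℝ) :
    S.nu φ ψ = truncation S.ℓ (fun t => ∫ τ in (0 : ℝ)..t, S.D₂ φ ψ τ) := rfl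

theorem Slits.vanishesOff_omega (S : Slits) (hφ : ContDiff ℝ 2 φ) (hψ : ContDiff ℝ 1 ψ) :
    VanishesOff S.ℓ (S.omega φ ψ) := by
  rw [S.omega_eq_truncation hφ hψ]; exact vanishesOff_truncation _ _

theorem Slits.vanishesOff_nu (S : Slits) (φ ψ : ℝ → ℝ) : VanishesOff S.ℓ (S.nu φ ψ) :=
  vanishesOff_truncation _ _

/-- The symmetric part of the emitted pulse, a primitive of `ω / 2`. -/
def Slits.evenPulse (S : Slits) (φ ψ : ℝ → ℝ) (s : ℝ) : ℝ :=
  1 / 2 * ∫ τ in (0 : ℝ)..s, S.omega φ ψ τ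

theorem Slits.evenPulse_of_nonpos (S : Slits) (hφ : ContDiff ℝ 2 φ) (hψ : ContDiff ℝ 1 ψ) :
    ∀ s ≤ 0, S.evenPulse φ ψ s = 0 := by
  intro s hs
  have : ∫ τ in (0 : ℝ)..s, S.omega φ ψ τ = ∫ _τ in (0 : ℝ)..s, (0 : ℝ) := by
    refine intervalIntegral.integral_congr fun τ hτ => ?_
    rw [uIcc_of_ge hs] at hτ
    exact S.vanishesOff_omega hφ hψ τ (Or.inl hτ.2)
  rw [Slits.evenPulse, this]; simp

theorem Slits.U_eq_outgoing (S : Slits) (hφ : ContDiff ℝ 2 φ) (hψ : ContDiff ℝ 1 ψ) (x t : ℝ) :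
    S.U φ ψ x t = outgoing (S.evenPulse φ ψ) (fun s => -1 / 2 * S.nu φ ψ s) (x, t) := by
  simp only [Slits.U, outgoing]
  rcases le_or_gt (t - |x|) 0 with h | h
  · rw [S.evenPulse_of_nonpos hφ hψ _ h, S.vanishesOff_nu φ ψ _ (Or.inl h), heaviside,
      if_neg (not_lt.2 h)]
    ring
  · rw [heaviside, if_pos h, Slits.evenPulse]; ring

theorem Slits.solution_eq (S : Slits) (hφ : ContDiff ℝ 2 φ) (hψ : ContDiff ℝ 1 ψ) :
    S.solution φ ψ = fun p => uD φ ψ p -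
      S.slitWaves (S.evenPulse φ ψ) (fun s => -1 / 2 * S.nu φ ψ s) p := by
  funext p
  rw [Slits.solution, S.U_eq_outgoing hφ hψ, S.U_eq_outgoing hφ hψ, Slits.slitWaves]
  ring

theorem Slits.Solvable.continuous_omega (h : S.Solvable φ ψ) (hφ : ContDiff ℝ 2 φ)
    (hψ : ContDiff ℝ 1 ψ) : Continuous (S.omega φ ψ) := by
  rw [S.omega_eq_truncation hφ hψ]
  exact continuous_truncation (S.contDiff_deriv_D₁ hφ hψ).continuous h.deriv_D₁_zero h.deriv_D₁_ℓ

theorem Slits.Solvable.hasDerivAt_omega (h : S.Solvable φ ψ) (hφ : ContDiff ℝ 2 φ)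
    (hψ : ContDiff ℝ 1 ψ) (t : ℝ) :
    HasDerivAt (S.omega φ ψ) (truncation S.ℓ (deriv (deriv (S.D₁ φ ψ))) t) t := by
  rw [S.omega_eq_truncation hφ hψ]
  exact hasDerivAt_truncation
    (fun t => ((S.contDiff_deriv_D₁ hφ hψ).differentiable (by norm_num) t).hasDerivAt)
    h.deriv_D₁_zero h.deriv_D₁_ℓ h.deriv2_D₁_zero h.deriv2_D₁_ℓ t

theorem Slits.Solvable.hasDerivAt_evenPulse (h : S.Solvable φ ψ) (hφ : ContDiff ℝ 2 φ)
    (hψ : ContDiff ℝ 1 ψ) (t : ℝ) :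
    HasDerivAt (S.evenPulse φ ψ) (1 / 2 * S.omega φ ψ t) t := by
  have hc := h.continuous_omega hφ hψ
  exact (intervalIntegral.integral_hasDerivAt_right (hc.intervalIntegrable _ _)
    hc.stronglyMeasurable.stronglyMeasurableAtFilter hc.continuousAt).const_mul _

theorem Slits.Solvable.hasDerivAt_nu (h : S.Solvable φ ψ) (hφ : ContDiff ℝ 2 φ)
    (hψ : ContDiff ℝ 1 ψ) (t : ℝ) :
    HasDerivAt (S.nu φ ψ) (truncation S.ℓ (S.D₂ φ ψ) t) t := by
  have hc := (S.contDiff_D₂ hφ hψ).continuous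
  rw [S.nu_eq_truncation]
  exact hasDerivAt_truncation (fun t => intervalIntegral.integral_hasDerivAt_right
    (hc.intervalIntegrable _ _) hc.stronglyMeasurable.stronglyMeasurableAtFilter hc.continuousAt)
    (by simp) h.integral_D₂ h.D₂_zero h.D₂_ℓ t

theorem Slits.Solvable.hasDerivAt_truncation_D₂ (h : S.Solvable φ ψ) (hφ : ContDiff ℝ 2 φ)
    (hψ : ContDiff ℝ 1 ψ) (t : ℝ) :
    HasDerivAt (truncation S.ℓ (S.D₂ φ ψ)) (truncation S.ℓ (deriv (S.D₂ φ ψ)) t) t :=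
  hasDerivAt_truncation
    (fun t => ((S.contDiff_D₂ hφ hψ).differentiable (by norm_num) t).hasDerivAt)
    h.D₂_zero h.D₂_ℓ h.deriv_D₂_zero h.deriv_D₂_ℓ t

theorem Slits.Solvable.evenPulse_eq (h : S.Solvable φ ψ) (hφ : ContDiff ℝ 2 φ)
    (hψ : ContDiff ℝ 1 ψ) {t : ℝ} (ht : t ∈ Icc 0 S.ℓ) :
    S.evenPulse φ ψ t = 1 / 2 * (S.D₁ φ ψ t - S.D₁ φ ψ 0) := by
  have e : ∫ τ in (0 : ℝ)..t, S.omega φ ψ τ = ∫ τ in (0 : ℝ)..t, deriv (S.D₁ φ ψ) τ := by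
    refine intervalIntegral.integral_congr fun τ hτ => ?_
    rw [uIcc_of_le ht.1] at hτ
    rw [S.omega_eq_truncation hφ hψ]
    exact truncation_eq h.deriv_D₁_zero h.deriv_D₁_ℓ ⟨hτ.1, hτ.2.trans ht.2⟩
  rw [Slits.evenPulse, e, intervalIntegral.integral_eq_sub_of_hasDerivAt
    (fun τ _ => (S.hasDerivAt_D₁ hφ hψ τ).differentiableAt.hasDerivAt)
    ((S.contDiff_deriv_D₁ hφ hψ).continuous.intervalIntegrable _ _)]

theorem Slits.Solvable.evenPulse_of_ge (h : S.Solvable φ ψ) (hφ : ContDiff ℝ 2 φ)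
    (hψ : ContDiff ℝ 1 ψ) : ∀ s, S.ℓ ≤ s → S.evenPulse φ ψ s = S.evenPulse φ ψ S.ℓ := by
  intro s hs
  have hc := h.continuous_omega hφ hψ
  have : ∫ τ in S.ℓ..s, S.omega φ ψ τ = ∫ _τ in S.ℓ..s, (0 : ℝ) := by
    refine intervalIntegral.integral_congr fun τ hτ => ?_
    rw [uIcc_of_le hs] at hτ
    exact S.vanishesOff_omega hφ hψ τ (Or.inr hτ.1)
  rw [Slits.evenPulse, Slits.evenPulse, ← intervalIntegral.integral_add_adjacent_intervals
    (hc.intervalIntegrable 0 S.ℓ) (hc.intervalIntegrable S.ℓ s), this]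
  simp

/-- The waves by which the explicit solution differs from `u^D`. -/
theorem Slits.Solvable.isCauchySol_slitWaves (h : S.Solvable φ ψ) (hS : S.Admissible)
    (hφ : ContDiff ℝ 2 φ) (hψ : ContDiff ℝ 1 ψ) :
    S.IsCauchySol 0 0 (S.slitWaves (S.evenPulse φ ψ) (fun s => -1 / 2 * S.nu φ ψ s)) :=
  hS.isCauchySol_slitWaves (h.hasDerivAt_evenPulse hφ hψ)
    (fun s => (h.hasDerivAt_nu hφ hψ s).const_mul _)
    (fun s => (h.hasDerivAt_omega hφ hψ s).const_mul _)
    (fun s => (h.hasDerivAt_truncation_D₂ hφ hψ s).const_mul _)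
    ((continuous_truncation ((S.contDiff_deriv_D₁ hφ hψ).continuous_deriv le_rfl)
      h.deriv2_D₁_zero h.deriv2_D₁_ℓ).const_mul _)
    ((continuous_truncation ((S.contDiff_D₂ hφ hψ).continuous_deriv le_rfl)
      h.deriv_D₂_zero h.deriv_D₂_ℓ).const_mul _)
    (S.evenPulse_of_nonpos hφ hψ) ((S.vanishesOff_omega hφ hψ).const_mul _)
    ((S.vanishesOff_nu φ ψ).const_mul _) ((vanishesOff_truncation _ _).const_mul _)
    ((vanishesOff_truncation _ _).const_mul _) ((vanishesOff_truncation _ _).const_mul _)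

theorem Slits.Solvable.isCauchySol_solution (h : S.Solvable φ ψ) (hS : S.Admissible)
    (hφ : ContDiff ℝ 2 φ) (hψ : ContDiff ℝ 1 ψ) : S.IsCauchySol φ ψ (S.solution φ ψ) := by
  rw [S.solution_eq hφ hψ]
  simpa using (S.isCauchySol_uD hφ hψ).sub (h.isCauchySol_slitWaves hS hφ hψ)

theorem Slits.Solvable.hasFDerivAt_solution (h : S.Solvable φ ψ) (hS : S.Admissible)
    (hφ : ContDiff ℝ 2 φ) (hψ : ContDiff ℝ 1 ψ) {p : ℝ × ℝ} (hp : p ∈ S.Dom) :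
    HasFDerivAt (S.solution φ ψ)
      (covec (uDx φ ψ p - S.slitWaves (fun s => -(-1 / 2 * truncation S.ℓ (S.D₂ φ ψ) s))
          (fun s => -(1 / 2 * S.omega φ ψ s)) p)
        (uDt φ ψ p - S.slitWaves (fun s => 1 / 2 * S.omega φ ψ s)
          (fun s => -1 / 2 * truncation S.ℓ (S.D₂ φ ψ) s) p)) p := by
  rw [S.solution_eq hφ hψ]
  refine ((hasFDerivAt_uD hφ hψ p).sub (hS.hasFDerivAt_slitWaves (h.hasDerivAt_evenPulse hφ hψ)
    (fun s => (h.hasDerivAt_nu hφ hψ s).const_mul _) ((S.vanishesOff_omega hφ hψ).const_mul _)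
    ((S.vanishesOff_nu φ ψ).const_mul _) ((vanishesOff_truncation _ _).const_mul _)
    hp)).congr_fderiv ?_
  ext <;> simp

/-- The one-sided limits of the explicit solution at the slits. -/
theorem Slits.Solvable.tendsto_solution (h : S.Solvable φ ψ) (hS : S.Admissible)
    (hφ : ContDiff ℝ 2 φ) (hψ : ContDiff ℝ 1 ψ) {σ t : ℝ} (hσ : σ * σ = 1)
    (ht : t ∈ Icc 0 S.ℓ) :
    Tendsto (S.solution φ ψ) (S.side σ S.a₁ (S.b₁ + t))
      (𝓝 (uD φ ψ (S.a₁, S.b₁ + t) - -(S.evenPulse φ ψ t + σ * (-1 / 2 * S.nu φ ψ t)))) ∧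
    Tendsto (S.solution φ ψ) (S.side σ S.a₂ (S.b₂ + t))
      (𝓝 (uD φ ψ (S.a₂, S.b₂ + t) - (S.evenPulse φ ψ t + σ * (-1 / 2 * S.nu φ ψ t) -
        S.evenPulse φ ψ S.ℓ))) := by
  have cE : Continuous (S.evenPulse φ ψ) := continuous_iff_continuousAt.2 fun s =>
    (h.hasDerivAt_evenPulse hφ hψ s).continuousAt
  have cN : Continuous (S.nu φ ψ) := continuous_iff_continuousAt.2 fun s =>
    (h.hasDerivAt_nu hφ hψ s).continuousAt
  have cU : ∀ a b, Tendsto (uD φ ψ) (S.side σ a b) (𝓝 (uD φ ψ (a, b))) := fun a b =>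
    ((contDiff_uD hφ hψ).continuous.tendsto _).mono_left (S.side_le_nhds σ a b)
  rw [S.solution_eq hφ hψ]
  exact ⟨(cU _ _).sub (hS.tendsto_slitWaves_lower cE (cN.const_mul _)
      (S.evenPulse_of_nonpos hφ hψ) ((S.vanishesOff_nu φ ψ).const_mul _) hσ ht),
    (cU _ _).sub (hS.tendsto_slitWaves_upper cE (cN.const_mul _)
      (h.evenPulse_of_ge hφ hψ) ((S.vanishesOff_nu φ ψ).const_mul _) hσ ht)⟩

/-- One-sided limits at the slits for the difference of a continuous function and waves with
truncated pulses. -/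
theorem Slits.Admissible.tendsto_sub_slitWaves (hS : S.Admissible) {f g : ℝ × ℝ → ℝ}
    {A B : ℝ → ℝ} (hf : Continuous f) (hA : Continuous A) (hB : Continuous B)
    (hA0 : VanishesOff S.ℓ A) (hB0 : VanishesOff S.ℓ B)
    (hg : EqOn g (fun p => f p - S.slitWaves A B p) S.Dom) {σ t : ℝ} (hσ : σ * σ = 1)
    (ht : t ∈ Icc 0 S.ℓ) :
    Tendsto g (S.side σ S.a₁ (S.b₁ + t)) (𝓝 (f (S.a₁, S.b₁ + t) + (A t + σ * B t))) ∧
    Tendsto g (S.side σ S.a₂ (S.b₂ + t)) (𝓝 (f (S.a₂, S.b₂ + t) - (A t + σ * B t))) := by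
  have c : ∀ a b, Tendsto f (S.side σ a b) (𝓝 (f (a, b))) := fun a b =>
    (hf.tendsto _).mono_left (S.side_le_nhds σ a b)
  have e : ∀ a b, (fun p => f p - S.slitWaves A B p) =ᶠ[S.side σ a b] g := fun a b =>
    mem_of_superset (S.Dom_mem_side σ a b) fun p hp => (hg hp).symm
  have h1 := (c _ _).sub (hS.tendsto_slitWaves_lower hA hB (fun s hs => hA0 s (Or.inl hs)) hB0
    hσ ht)
  have h2 := (c _ _).sub (hS.tendsto_slitWaves_upper hA hB
    (fun s hs => by rw [hA0 s (Or.inr hs), hA0 _ (Or.inr le_rfl)]) hB0 hσ ht)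
  rw [hA0 S.ℓ (Or.inr le_rfl), sub_zero] at h2
  rw [sub_neg_eq_add] at h1
  exact ⟨h1.congr' (e _ _), h2.congr' (e _ _)⟩

theorem Slits.Solvable.continuous_truncation_D₂ (h : S.Solvable φ ψ) (hφ : ContDiff ℝ 2 φ)
    (hψ : ContDiff ℝ 1 ψ) : Continuous (truncation S.ℓ (S.D₂ φ ψ)) :=
  continuous_truncation (S.contDiff_D₂ hφ hψ).continuous h.D₂_zero h.D₂_ℓ

theorem Slits.Solvable.tendsto_dx_solution (h : S.Solvable φ ψ) (hS : S.Admissible)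
    (hφ : ContDiff ℝ 2 φ) (hψ : ContDiff ℝ 1 ψ) {σ t : ℝ} (hσ : σ * σ = 1)
    (ht : t ∈ Icc 0 S.ℓ) :
    Tendsto (S.dx (S.solution φ ψ)) (S.side σ S.a₁ (S.b₁ + t)) (𝓝 (uDx φ ψ (S.a₁, S.b₁ + t) +
      (-(-1 / 2 * truncation S.ℓ (S.D₂ φ ψ) t) + σ * -(1 / 2 * S.omega φ ψ t)))) ∧
    Tendsto (S.dx (S.solution φ ψ)) (S.side σ S.a₂ (S.b₂ + t)) (𝓝 (uDx φ ψ (S.a₂, S.b₂ + t) -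
      (-(-1 / 2 * truncation S.ℓ (S.D₂ φ ψ) t) + σ * -(1 / 2 * S.omega φ ψ t)))) := by
  refine hS.tendsto_sub_slitWaves (A := fun s => -(-1 / 2 * truncation S.ℓ (S.D₂ φ ψ) s))
    (B := fun s => -(1 / 2 * S.omega φ ψ s)) (contDiff_uDx hφ hψ).continuous
    ((h.continuous_truncation_D₂ hφ hψ).const_mul _).neg
    ((h.continuous_omega hφ hψ).const_mul _).neg ?_ ?_ (fun p hp => ?_) hσ ht
  · intro s hs; simp [vanishesOff_truncation S.ℓ (S.D₂ φ ψ) s hs]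
  · intro s hs; simp [S.vanishesOff_omega hφ hψ s hs]
  · exact Slits.dx_eq_of_hasFDerivWithinAt hp
      (h.hasFDerivAt_solution hS hφ hψ hp).hasFDerivWithinAt

theorem Slits.Solvable.tendsto_dt_solution (h : S.Solvable φ ψ) (hS : S.Admissible)
    (hφ : ContDiff ℝ 2 φ) (hψ : ContDiff ℝ 1 ψ) {σ t : ℝ} (hσ : σ * σ = 1)
    (ht : t ∈ Icc 0 S.ℓ) :
    Tendsto (S.dt (S.solution φ ψ)) (S.side σ S.a₁ (S.b₁ + t)) (𝓝 (uDt φ ψ (S.a₁, S.b₁ + t) +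
      (1 / 2 * S.omega φ ψ t + σ * (-1 / 2 * truncation S.ℓ (S.D₂ φ ψ) t)))) ∧
    Tendsto (S.dt (S.solution φ ψ)) (S.side σ S.a₂ (S.b₂ + t)) (𝓝 (uDt φ ψ (S.a₂, S.b₂ + t) -
      (1 / 2 * S.omega φ ψ t + σ * (-1 / 2 * truncation S.ℓ (S.D₂ φ ψ) t)))) :=
  hS.tendsto_sub_slitWaves (A := fun s => 1 / 2 * S.omega φ ψ s)
    (B := fun s => -1 / 2 * truncation S.ℓ (S.D₂ φ ψ) s) (contDiff_uDt hφ hψ).continuous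
    ((h.continuous_omega hφ hψ).const_mul _) ((h.continuous_truncation_D₂ hφ hψ).const_mul _)
    ((S.vanishesOff_omega hφ hψ).const_mul _) ((vanishesOff_truncation _ _).const_mul _)
    (fun _ hp => Slits.dt_eq_of_hasFDerivWithinAt hp
      (h.hasFDerivAt_solution hS hφ hψ hp).hasFDerivWithinAt) hσ ht

theorem Slits.sideLimits_of_tendsto {F : ℝ × ℝ → ℝ} {x y : ℝ → ℝ → ℝ}
    (h : ∀ {σ t : ℝ}, σ * σ = 1 → t ∈ Icc 0 S.ℓ →
      Tendsto F (S.side σ S.a₁ (S.b₁ + t)) (𝓝 (x σ t)) ∧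
        Tendsto F (S.side σ S.a₂ (S.b₂ + t)) (𝓝 (y σ t))) : S.SideLimits F := by
  intro t ht
  simp only [S.fromLeft_eq_side, S.fromRight_eq_side]
  have hp := h (σ := 1) (by norm_num) ht
  have hm := h (σ := -1) (by norm_num) ht
  exact ⟨⟨_, hm.1⟩, ⟨_, hp.1⟩, ⟨_, hm.2⟩, ⟨_, hp.2⟩⟩

theorem Slits.glued_of_tendsto {F : ℝ × ℝ → ℝ} {x y : ℝ → ℝ → ℝ}
    (h : ∀ {σ t : ℝ}, σ * σ = 1 → t ∈ Icc 0 S.ℓ →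
      Tendsto F (S.side σ S.a₁ (S.b₁ + t)) (𝓝 (x σ t)) ∧
        Tendsto F (S.side σ S.a₂ (S.b₂ + t)) (𝓝 (y σ t)))
    (hxy : ∀ σ, ∀ t ∈ Icc 0 S.ℓ, x σ t = y (-σ) t) : S.Glued F := by
  intro t ht
  simp only [S.fromLeft_eq_side, S.fromRight_eq_side]
  have hp := h (σ := 1) (by norm_num) ht
  have hm := h (σ := -1) (by norm_num) ht
  refine ⟨⟨_, hm.1, ?_⟩, ⟨_, hp.1, ?_⟩⟩
  · rw [hxy (-1) t ht, neg_neg]; exact hp.2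
  · rw [hxy 1 t ht]; exact hm.2

theorem Slits.Solvable.isStrongSol_solution (h : S.Solvable φ ψ) (hS : S.Admissible)
    (hφ : ContDiff ℝ 2 φ) (hψ : ContDiff ℝ 1 ψ) : S.IsStrongSol φ ψ (S.solution φ ψ) := by
  have hc := h.isCauchySol_solution hS hφ hψ
  have hℓ : S.ℓ ∈ Icc 0 S.ℓ := ⟨hS.hℓ.le, le_rfl⟩
  exact
    { classK :=
        { contDiff_two := hc.contDiff_two
          contDiff_one := hc.contDiff_one
          lim_u := Slits.sideLimits_of_tendsto (h.tendsto_solution hS hφ hψ)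
          lim_dx := Slits.sideLimits_of_tendsto (h.tendsto_dx_solution hS hφ hψ)
          lim_dt := Slits.sideLimits_of_tendsto (h.tendsto_dt_solution hS hφ hψ) }
      wave := hc.wave
      init := hc.init
      init_dt := hc.init_dt
      glue_u := Slits.glued_of_tendsto (h.tendsto_solution hS hφ hψ) fun σ t ht => by
        have e : S.D₁ φ ψ t = uD φ ψ (S.a₂, S.b₂ + t) - uD φ ψ (S.a₁, S.b₁ + t) := rfl
        have hD := h.D₁_add
        rw [h.evenPulse_eq hφ hψ ht, h.evenPulse_eq hφ hψ hℓ]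
        linarith
      glue_dx := Slits.glued_of_tendsto (h.tendsto_dx_solution hS hφ hψ) fun σ t ht => by
        have e : S.D₂ φ ψ t = uDx φ ψ (S.a₂, S.b₂ + t) - uDx φ ψ (S.a₁, S.b₁ + t) := rfl
        rw [truncation_eq h.D₂_zero h.D₂_ℓ ht]
        linarith }

theorem Slits.Solvable.hasJump_solution (h : S.Solvable φ ψ) (hS : S.Admissible)
    (hφ : ContDiff ℝ 2 φ) (hψ : ContDiff ℝ 1 ψ) {t : ℝ} (ht : t ∈ Icc 0 S.ℓ) :
    S.HasJump (S.solution φ ψ) S.a₂ (S.b₂ + t) (S.nu φ ψ t) ∧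
      S.HasJump (S.dx (S.solution φ ψ)) S.a₂ (S.b₂ + t) (S.omega φ ψ t) := by
  simp only [Slits.HasJump, S.fromLeft_eq_side, S.fromRight_eq_side]
  exact ⟨⟨_, _, (h.tendsto_solution hS hφ hψ (σ := 1) (by norm_num) ht).2,
      (h.tendsto_solution hS hφ hψ (σ := -1) (by norm_num) ht).2, by ring⟩,
    ⟨_, _, (h.tendsto_dx_solution hS hφ hψ (σ := 1) (by norm_num) ht).2,
      (h.tendsto_dx_solution hS hφ hψ (σ := -1) (by norm_num) ht).2, by ring⟩⟩

end Solution

/-! ### Strengthened classical solutions -/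

section StrongSolutions

variable {S : Slits} {φ ψ : ℝ → ℝ} {u v : ℝ × ℝ → ℝ}

theorem Slits.HasJump.congr {F G : ℝ × ℝ → ℝ} {A B j : ℝ} (h : S.HasJump F A B j)
    (hFG : EqOn F G S.Dom) : S.HasJump G A B j := by
  obtain ⟨r, l, hr, hl, e⟩ := h
  refine ⟨r, l, hr.congr' ?_, hl.congr' ?_, e⟩
  · filter_upwards [self_mem_nhdsWithin] with p hp using hFG hp.1
  · filter_upwards [self_mem_nhdsWithin] with p hp using hFG hp.1

theorem LimEq.congr {F F' : ℝ × ℝ → ℝ} {l m : Filter (ℝ × ℝ)} (h : LimEq F l F m)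
    (hl : F =ᶠ[l] F') (hm : F =ᶠ[m] F') : LimEq F' l F' m := by
  obtain ⟨L, h1, h2⟩ := h
  exact ⟨L, h1.congr' hl, h2.congr' hm⟩

theorem Slits.Glued.congr {F G : ℝ × ℝ → ℝ} (h : S.Glued F) (hFG : EqOn F G S.Dom) :
    S.Glued G := by
  intro t ht
  have e : ∀ {T : Set (ℝ × ℝ)} {p : ℝ × ℝ}, F =ᶠ[𝓝[S.Dom ∩ T] p] G := by
    intro T p
    filter_upwards [self_mem_nhdsWithin] with q hq using hFG hq.1
  exact ⟨(h t ht).1.congr e e, (h t ht).2.congr e e⟩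

theorem Slits.Glued.sub {F G : ℝ × ℝ → ℝ} (hF : S.Glued F) (hG : S.Glued G) :
    S.Glued (fun p => F p - G p) := by
  have e : ∀ {l m : Filter (ℝ × ℝ)}, LimEq F l F m → LimEq G l G m →
      LimEq (fun p => F p - G p) l (fun p => F p - G p) m := by
    rintro l m ⟨L, h1, h2⟩ ⟨L', h1', h2'⟩
    exact ⟨L - L', h1.sub h1', h2.sub h2'⟩
  exact fun t ht => ⟨e (hF t ht).1 (hG t ht).1, e (hF t ht).2 (hG t ht).2⟩

theorem Slits.IsStrongSol.solvable (hS : S.Admissible) (hφ : ContDiff ℝ 2 φ)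
    (hψ : ContDiff ℝ 1 ψ) (hu : S.IsStrongSol φ ψ u) : S.Solvable φ ψ := by
  have hD := S.isCauchySol_uD hφ hψ
  have hw : S.IsCauchySol 0 0 (fun p => u p - uD φ ψ p) := by
    simpa using hu.isCauchySol.sub hD
  refine hw.solvable hS hφ hψ (by simpa using hu.glue_u) (hu.glue_dx.congr fun p hp => ?_)
  rw [Slits.dx_sub hu.isCauchySol.contDiff_one hD.contDiff_one hp, S.dx_uD hφ hψ hp,
    sub_add_cancel]

theorem Slits.IsStrongSol.eqOn (hS : S.Admissible) (hu : S.IsStrongSol φ ψ u)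
    (hv : S.IsStrongSol φ ψ v) : EqOn u v S.Dom := by
  have hw : S.IsCauchySol 0 0 (fun p => u p - v p) := by
    simpa using hu.isCauchySol.sub hv.isCauchySol
  intro p hp
  refine sub_eq_zero.1 (hw.eq_zero_of_glued hS (hu.glue_u.sub hv.glue_u)
    ((hu.glue_dx.sub hv.glue_dx).congr fun q hq => ?_) p hp)
  exact (Slits.dx_sub hu.isCauchySol.contDiff_one hv.isCauchySol.contDiff_one hq).symm

end StrongSolutions

end SlitWave

end

theorem theorem5p3 (S : SlitWave.Slits) (hℓ : 0 < S.ℓ) (hb₁ : 0 ≤ S.b₁) (ha : S.a₁ < S.a₂)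
    (hb : S.b₁ + S.ℓ + S.a₂ - S.a₁ < S.b₂)
    (φ ψ : ℝ → ℝ) (hφ : ContDiff ℝ 2 φ) (hψ : ContDiff ℝ 1 ψ) :
    -- a unique strengthened classical solution exists iff the data are solvable
    ((∃ u : ℝ × ℝ → ℝ, S.IsStrongSol φ ψ u ∧
        ∀ v : ℝ × ℝ → ℝ, S.IsStrongSol φ ψ v → Set.EqOn v u S.Dom) ↔ S.Solvable φ ψ) ∧
    -- in that case the explicit formula is a strengthened classical solution
    (S.Solvable φ ψ → S.IsStrongSol φ ψ (S.solution φ ψ)) ∧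
    -- every strengthened classical solution is given by the formula, with jumps ν and ω at
    -- the upper slit
    (∀ u : ℝ × ℝ → ℝ, S.IsStrongSol φ ψ u →
      Set.EqOn u (S.solution φ ψ) S.Dom ∧
      ∀ t ∈ Set.Icc 0 S.ℓ,
        S.HasJump u S.a₂ (S.b₂ + t) (S.nu φ ψ t) ∧
        S.HasJump (S.dx u) S.a₂ (S.b₂ + t) (S.omega φ ψ t)) := by
  have hS : S.Admissible := ⟨hℓ, hb₁, ha, hb⟩
  refine ⟨⟨fun ⟨u, hu, _⟩ => hu.solvable hS hφ hψ, fun h => ⟨S.solution φ ψ,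
    h.isStrongSol_solution hS hφ hψ, fun v hv =>
      hv.eqOn hS (h.isStrongSol_solution hS hφ hψ)⟩⟩,
    fun h => h.isStrongSol_solution hS hφ hψ, fun u hu => ?_⟩
  have h := hu.solvable hS hφ hψ
  have e := hu.eqOn hS (h.isStrongSol_solution hS hφ hψ)
  refine ⟨e, fun t ht => ?_⟩
  obtain ⟨j1, j2⟩ := h.hasJump_solution hS hφ hψ ht
  refine ⟨j1.congr e.symm, j2.congr fun p hp => ?_⟩
  exact (congrArg (fun L : ℝ × ℝ →L[ℝ] ℝ => L (1, 0)) (fderivWithin_congr e (e hp))).symm
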